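/- Let $(\mathcal H,\langle\cdot,\cdot\rangle)$ be a complex Hilbert space and $A$ a bounded selfadjoint operator on $\mathcal H$, with resolvent set $\rho(A)$. A Kreĭn space is a complex vector space $\mathcal K$ with a Hermitian inner product $[\cdot,\cdot]$ admitting a decomposition (a fundamental decomposition) $\mathcal K=\mathcal K_+\dot+\mathcal K_-$, orthogonal with respect to $[\cdot,\cdot]$, such that $(\mathcal K_+,[\cdot,\cdot])$ and $(\mathcal K_-,-[\cdot,\cdot])$ are Hilbert spaces; it carries the topology of the Hilbert space inner product $\langle x_++x_-,y_++y_-\rangle=[x_+,y_+]-[x_-,y_-]$, which does not depend on the fundamental decomposition. A Kreĭn space induced by $A$ is a pair $(\mathcal K,\Pi)$ where $\mathcal K$ is a Kreĭn space and $\Pi\colon\mathcal H\to\mathcal K$ is a bounded linear operator with dense range such that $[\Pi x,\Pi y]=\langle Ax,y\rangle$ for all $x,y\in\mathcal H$. Two such pairs $(\mathcal K_1,\Pi_1)$, $(\mathcal K_2,\Pi_2)$ are unitarily equivalent if there is a bounded linear bijection $U\colon\mathcal K_1\to\mathcal K_2$ with bounded inverse such that $[Ux,Uy]=[x,y]$ for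 all $x,y\in\mathcal K_1$ and $U\Pi_1=\Pi_2$. For a subspace $\mathcal L$ of $\mathcal K$ let $\mathcal L^\perp=\{x\in\mathcal K : [x,y]=0 \text{ for all } y\in\mathcal L\}$. A closed subspace $\mathcal L$ of $\mathcal K$ is called uniformly positive (uniformly negative) if $\mathcal K=\mathcal L+\mathcal L^\perp$ and $[x,x]>0$ (respectively $[x,x]<0$) for all $x\in\mathcal L\setminus\{0\}$. A subspace is called maximal uniformly definite if it is maximal, with respect to inclusion, among the uniformly positive subspaces, or maximal among the uniformly negative subspaces. The following statements are equivalent: 1. The Kreĭn space induced by $A$ exists and is unique up to unitary equivalence. 2. There exists $\varepsilon>0$ such that $(0,\varepsilon)\subset\rho(A)$ or $(-\varepsilon,0)\subset\rho(A)$. 3. For some Kreĭn space $(\mathcal K,\Pi)$ induced by $A$, the range of $\Pi$ contains a maximal uniformly definite subspace of $\mathcal K$. 4. For every Kreĭn space $(\mathcal K,\Pi)$ induced by $A$, the range of $\Pi$ contains a maximal uniformly definite subspace of $\mathcal K$. -/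

import Mathlib

open scoped ComplexConjugate InnerProductSpace

universe u

/-- A Kreĭn space: a complex vector space `K` with an indefinite Hermitian inner product `form`
and a direct decomposition `K = K₊ [+] K₋`, orthogonal with respect to `form`, such that
`K₊` is a Hilbert space under `form` and `K₋` is a Hilbert space under `-form`.
As usual, `K` is normed by means of a fundamental decomposition: the ambient Hilbert space
inner product of `K` is required to be the one of some fundamental decomposition, i.e.
`⟪x₊ + x₋, y₊ + y₋⟫ = form x₊ y₊ - form x₋ y₋`.  (The norms belonging to different fundamental
decompositions are equivalent; nothing below but the topology depends on that choice.
Completeness of `K` is the same as completeness of both `K₊` and `K₋`.)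
As in Mathlib, sesquilinear forms are conjugate linear in the first variable. -/
class KreinSpace (K : Type u) [NormedAddCommGroup K] [InnerProductSpace ℂ K]
    [CompleteSpace K] where
  /-- the indefinite inner product -/
  form : K →ₗ⋆[ℂ] K →ₗ[ℂ] ℂ
  form_conj_symm : ∀ x y : K, conj (form x y) = form y x
  exists_fundamental_decomposition : ∃ Kp Km : Submodule ℂ K,
    IsCompl Kp Km ∧
    (∀ x ∈ Kp, ∀ y ∈ Km, form x y = 0) ∧
    ∀ xp ∈ Kp, ∀ xm ∈ Km, ∀ yp ∈ Kp, ∀ ym ∈ Km,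
      ⟪xp + xm, yp + ym⟫_ℂ = form xp yp - form xm ym

namespace KreinSpace

section

variable {K : Type u} [NormedAddCommGroup K] [InnerProductSpace ℂ K] [CompleteSpace K]
  [KreinSpace K]

/-- The orthogonal companion `{x | [y, x] = 0 for all y ∈ L}` of a subspace, with respect to
the indefinite inner product. -/
def companion (L : Submodule ℂ K) : Submodule ℂ K :=
  L.orthogonalBilin (form (K := K))

/-- A closed subspace `L` is regular if `K = L + L^⊥`, the complement being taken with respect
to the indefinite inner product. -/
def IsRegular (L : Submodule ℂ K) : Prop :=
  IsClosed (L : Set K) ∧ L ⊔ companion L = ⊤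

/-- `[x, x] > 0` for all nonzero `x ∈ L` (the number `[x, x]` is always real). -/
def IsPositive (L : Submodule ℂ K) : Prop :=
  ∀ x ∈ L, x ≠ 0 → 0 < (form x x).re

/-- `[x, x] < 0` for all nonzero `x ∈ L` (the number `[x, x]` is always real). -/
def IsNegative (L : Submodule ℂ K) : Prop :=
  ∀ x ∈ L, x ≠ 0 → (form x x).re < 0

/-- Uniformly positive subspaces are the regular positive ones. -/
def IsUniformlyPositive (L : Submodule ℂ K) : Prop :=
  IsRegular L ∧ IsPositive L

/-- Uniformly negative subspaces are the regular negative ones. -/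
def IsUniformlyNegative (L : Submodule ℂ K) : Prop :=
  IsRegular L ∧ IsNegative L

/-- `L` is a maximal uniformly definite subspace: it is either maximal among the uniformly
positive subspaces or maximal among the uniformly negative subspaces. -/
def IsMaximalUniformlyDefinite (L : Submodule ℂ K) : Prop :=
  Maximal IsUniformlyPositive L ∨ Maximal IsUniformlyNegative L

end

end KreinSpace

/-- A Kreĭn space `(K, Π)` induced by a bounded operator `A` on a Hilbert space `H`:
a Kreĭn space `K` with a bounded operator `Π : H → K` of dense range such that the
indefinite inner product of `Π x`, `Π y` is `⟪x, A y⟫`.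

(The density of the range bounds the cardinality of `K`, so that every induced Kreĭn space
occurs, up to isomorphism, in the universe of `H`.) -/
structure InducedKreinSpace {H : Type u} [NormedAddCommGroup H] [InnerProductSpace ℂ H]
    (A : H →L[ℂ] H) where
  /-- the underlying space -/
  carrier : Type u
  [normedAddCommGroup : NormedAddCommGroup carrier]
  [innerProductSpace : InnerProductSpace ℂ carrier]
  [completeSpace : CompleteSpace carrier]
  [kreinSpace : KreinSpace carrier]
  /-- the operator `Π` -/
  map : H →L[ℂ] carrier
  denseRange_map : DenseRange map
  form_map_map : ∀ x y : H, KreinSpace.form (map x) (map y) = ⟪x, A y⟫_ℂ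

namespace InducedKreinSpace

attribute [instance] normedAddCommGroup innerProductSpace completeSpace kreinSpace

section

variable {H : Type u} [NormedAddCommGroup H] [InnerProductSpace ℂ H] {A : H →L[ℂ] H}

/-- Unitary equivalence of induced Kreĭn spaces `(K₁, Π₁)`, `(K₂, Π₂)`: there is a bounded and
boundedly invertible `U : K₁ → K₂`, isometric for the indefinite inner products, such that
`U Π₁ = Π₂`. -/
def UnitaryEquivalent (S T : InducedKreinSpace A) : Prop :=
  ∃ U : S.carrier ≃L[ℂ] T.carrier,
    (∀ x y : S.carrier, KreinSpace.form (U x) (U y) = KreinSpace.form x y) ∧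
    ∀ h : H, U (S.map h) = T.map h

/-- The range of `Π` contains a maximal uniformly definite subspace of `K`. -/
def RangeContainsMaximalUniformlyDefinite (S : InducedKreinSpace A) : Prop :=
  ∃ L : Submodule ℂ S.carrier,
    KreinSpace.IsMaximalUniformlyDefinite L ∧ (L : Set S.carrier) ⊆ Set.range S.map

end

end InducedKreinSpace

/-- There is a Kreĭn space induced by `A`, and any two of them are unitarily equivalent. -/
def InducedKreinSpaceUnique {H : Type u} [NormedAddCommGroup H] [InnerProductSpace ℂ H]
    (A : H →L[ℂ] H) : Prop :=
  Nonempty (InducedKreinSpace A) ∧ ∀ S T : InducedKreinSpace A, S.UnitaryEquivalent T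

/-- For some `ε > 0`, one of the intervals `(0, ε)` and `(-ε, 0)` lies in the resolvent set. -/
def HasLateralSpectralGapAtZero {H : Type u} [NormedAddCommGroup H] [InnerProductSpace ℂ H]
    (A : H →L[ℂ] H) : Prop :=
  ∃ ε : ℝ, 0 < ε ∧
    ((∀ t ∈ Set.Ioo (0 : ℝ) ε, (t : ℂ) ∈ resolventSet ℂ A) ∨
      (∀ t ∈ Set.Ioo (-ε) (0 : ℝ), (t : ℂ) ∈ resolventSet ℂ A))

/-!
Write the indefinite inner product of a Kreĭn space as `[x, y] = ⟪x, J y⟫` with a selfadjoint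
involution `J`.  Everything is proved for such `J`; replacing `(A, J)` by `(-A, -J)` exchanges the
two signs, so that only gaps to the right of `0` and uniformly positive subspaces are treated.

The link between the spectrum of `A` and the induced Kreĭn spaces is `HasPositiveSplitting A`: `H`
is the sum of two `A`-orthogonal subspaces `M`, `N`, with `A` uniformly positive on `M` and
nonpositive on `N`.  It is equivalent to a gap of the spectrum to the right of `0`.  In one
direction, testing `(A - t)(u + v)` against `u - v` shows that `A - t` is bounded below; in the
other, one takes for `M` the closure of the range of the positive part of `A`.

* A splitting of `H` is carried to any induced Kreĭn space `(K, Π)`: the image of `M` is maximal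
  uniformly positive, its companion is uniformly negative, and hence the norm of `Π x` is
  determined by `A` up to equivalence (`IsInduced.exists_norm_map_sq_equiv`).  So `Π₁ x ↦ Π₂ x`
  extends to a unitary equivalence of any two induced Kreĭn spaces.
* Conversely a maximal uniformly positive subspace in the range of `Π`, together with its
  companion, is pulled back to a splitting of `H` (`IsInduced.hasPositiveSplitting_of_maximal`).
* An induced Kreĭn space always exists: with `T = √A₊` and `S = √A₋` take
  `K = (ker T)ᗮ ⊕ (ker S)ᗮ` and `Π x = (T x, S x)` (`exists_canonical`).
* If there is no gap on either side, then the canonical space contains orthonormal sequences `e n`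
  in the positive and `f n` in the negative summand with `T (e n)` and `S (f n)` tending to `0` as
  fast as desired.  The vectors `z n = e n + f n` are neutral and mutually orthogonal, so
  `V x = x + i ∑ 2ⁿ [z n, x] z n` preserves `[·, ·]`.  It is unbounded, but `V Π` is bounded and has
  dense range, and so `V Π` is an induced Kreĭn space not equivalent to `Π`
  (`IsInduced.exists_not_factor`).
-/

namespace InducedKreinSpace

/-! ### Spectral gaps and splittings of a selfadjoint operator -/

section Operators

variable {H : Type*} [NormedAddCommGroup H] [InnerProductSpace ℂ H]

theorem re_inner_self_eq_norm_sq (x : H) : (⟪x, x⟫_ℂ).re = ‖x‖ ^ 2 :=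
  inner_self_eq_norm_sq (𝕜 := ℂ) x

theorem re_inner_le_norm_mul_norm (x y : H) : (⟪x, y⟫_ℂ).re ≤ ‖x‖ * ‖y‖ :=
  re_inner_le_norm (𝕜 := ℂ) x y

theorem re_inner_comm (x y : H) : (⟪x, y⟫_ℂ).re = (⟪y, x⟫_ℂ).re :=
  inner_re_symm (𝕜 := ℂ) x y

/-- The spectrum of `A` has a gap immediately to the right of `0`. -/
def HasRightSpectralGap (A : H →L[ℂ] H) : Prop :=
  ∃ ε : ℝ, 0 < ε ∧ ∀ t ∈ Set.Ioo (0 : ℝ) ε, (t : ℂ) ∈ resolventSet ℂ A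

theorem hasLateralSpectralGapAtZero_iff {H : Type u} [NormedAddCommGroup H]
    [InnerProductSpace ℂ H] (A : H →L[ℂ] H) :
    HasLateralSpectralGapAtZero A ↔ HasRightSpectralGap A ∨ HasRightSpectralGap (-A) := by
  have key : ∀ t : ℝ, ((-t : ℝ) : ℂ) ∈ resolventSet ℂ (-A) ↔ (t : ℂ) ∈ resolventSet ℂ A := by
    intro t
    rw [spectrum.mem_resolventSet_iff, spectrum.mem_resolventSet_iff, ← IsUnit.neg_iff]
    simp only [Complex.ofReal_neg, map_neg]
    rw [show -(-(algebraMap ℂ (H →L[ℂ] H)) (t : ℂ) - -A)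
      = algebraMap ℂ (H →L[ℂ] H) (t : ℂ) - A by abel]
  constructor
  · rintro ⟨ε, hε, h | h⟩
    · exact Or.inl ⟨ε, hε, h⟩
    · refine Or.inr ⟨ε, hε, fun t ht => ?_⟩
      have := (key (-t)).2 (h (-t) ⟨by linarith [ht.2], by linarith [ht.1]⟩)
      simpa using this
  · rintro (⟨ε, hε, h⟩ | ⟨ε, hε, h⟩)
    · exact ⟨ε, hε, Or.inl h⟩
    · exact ⟨ε, hε, Or.inr fun t ht =>
        (key t).1 (h (-t) ⟨by linarith [ht.2], by linarith [ht.1]⟩)⟩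

/-- A splitting `H = M + N`, orthogonal with respect to the form `⟪·, A ·⟫`, such that this form
is uniformly positive on the closed subspace `M` and nonpositive on `N`.  The sum need not be
orthogonal for the inner product of `H`. -/
def HasPositiveSplitting (A : H →L[ℂ] H) : Prop :=
  ∃ c : ℝ, 0 < c ∧ ∃ M N : Submodule ℂ H, IsClosed (M : Set H) ∧ M ⊔ N = ⊤ ∧
    (∀ u ∈ M, ∀ v ∈ N, ⟪u, A v⟫_ℂ = 0) ∧
    (∀ u ∈ M, c * ‖u‖ ^ 2 ≤ (⟪u, A u⟫_ℂ).re) ∧ ∀ v ∈ N, (⟪v, A v⟫_ℂ).re ≤ 0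

variable [CompleteSpace H]

theorem inner_map_comm {A : H →L[ℂ] H} (hA : IsSelfAdjoint A) (x y : H) :
    ⟪A x, y⟫_ℂ = ⟪x, A y⟫_ℂ :=
  hA.isSymmetric x y

theorem isUnit_of_isSelfAdjoint_of_mul_norm_le {T : H →L[ℂ] H} (hT : IsSelfAdjoint T) {δ : ℝ}
    (hδ : 0 < δ) (h : ∀ x, δ * ‖x‖ ≤ ‖T x‖) : IsUnit T := by
  have hanti : AntilipschitzWith (Real.toNNReal δ⁻¹) T := by
    refine T.antilipschitz_of_bound fun x => ?_
    rw [Real.coe_toNNReal _ (inv_pos.2 hδ).le, inv_mul_eq_div, le_div_iff₀ hδ, mul_comm]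
    exact h x
  rw [ContinuousLinearMap.isUnit_iff_bijective,
    ContinuousLinearMap.bijective_iff_dense_range_and_antilipschitz]
  refine ⟨?_, _, hanti⟩
  rw [Submodule.topologicalClosure_eq_top_iff, Submodule.eq_bot_iff]
  intro x hx
  have hx0 : T x = 0 := by
    refine ext_inner_left ℂ fun y => ?_
    rw [← inner_map_comm hT, inner_zero_right]
    exact hx (T y) ⟨y, rfl⟩
  exact hanti.injective (by rw [hx0, map_zero])

/-- With `x = u + v` along the splitting, testing `(A - t) x` against `u - v` shows that `A - t`
is bounded below for `0 < t < c`, hence invertible. -/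
theorem HasPositiveSplitting.hasRightSpectralGap {A : H →L[ℂ] H} (hA : IsSelfAdjoint A)
    (h : HasPositiveSplitting A) : HasRightSpectralGap A := by
  obtain ⟨c, hc, M, N, -, hMN, hort, hM, hN⟩ := h
  refine ⟨c, hc, fun t ht => ?_⟩
  obtain ⟨δ, hδ, hδt, hδc⟩ : ∃ δ : ℝ, 0 < δ ∧ δ ≤ t ∧ δ ≤ c - t :=
    ⟨min t (c - t), lt_min ht.1 (sub_pos.2 ht.2), min_le_left _ _, min_le_right _ _⟩
  set B : H →L[ℂ] H := algebraMap ℂ (H →L[ℂ] H) (t : ℂ) - A with hBdef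
  have hB : IsSelfAdjoint B := by
    refine IsSelfAdjoint.sub ?_ hA
    rw [IsSelfAdjoint, ← algebraMap_star_comm]
    simp
  refine isUnit_of_isSelfAdjoint_of_mul_norm_le hB (half_pos hδ) fun x => ?_
  obtain ⟨u, hu, v, hv, rfl⟩ := Submodule.mem_sup.1 (hMN ▸ Submodule.mem_top : x ∈ M ⊔ N)
  have h1 : (⟪v - u, B (u + v)⟫_ℂ).re
      = (⟪u, A u⟫_ℂ).re - (⟪v, A v⟫_ℂ).re - t * ‖u‖ ^ 2 + t * ‖v‖ ^ 2 := by
    have e1 : ⟪v, A u⟫_ℂ = 0 := by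
      rw [← inner_map_comm hA, ← inner_conj_symm, hort u hu v hv, map_zero]
    have e2 := hort u hu v hv
    have e3 : B (u + v) = (t : ℂ) • (u + v) - A (u + v) := by
      simp [hBdef, Algebra.algebraMap_eq_smul_one]
    rw [e3]
    simp only [map_add, inner_sub_left, inner_sub_right, inner_add_right, smul_add,
      inner_smul_right, e1, e2, Complex.sub_re, Complex.add_re, Complex.re_ofReal_mul,
      re_inner_self_eq_norm_sq, Complex.zero_re]
    rw [re_inner_comm v u]
    ring
  have h2 : δ * (‖u‖ ^ 2 + ‖v‖ ^ 2) ≤ ‖v - u‖ * ‖B (u + v)‖ := by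
    refine le_trans ?_ (re_inner_le_norm_mul_norm _ _)
    rw [h1]
    have := hM u hu
    have := hN v hv
    nlinarith [sq_nonneg ‖u‖, sq_nonneg ‖v‖]
  have h3 : (‖u‖ + ‖v‖) ^ 2 ≤ 2 * (‖u‖ ^ 2 + ‖v‖ ^ 2) := by
    nlinarith [sq_nonneg (‖u‖ - ‖v‖)]
  have h4 : ‖v - u‖ ≤ ‖u‖ + ‖v‖ := by rw [add_comm]; exact norm_sub_le _ _
  rcases eq_or_lt_of_le (show 0 ≤ ‖u‖ + ‖v‖ by positivity) with h0 | h0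
  · have : ‖u + v‖ = 0 := le_antisymm (h0 ▸ norm_add_le u v) (norm_nonneg _)
    rw [this, mul_zero]
    exact norm_nonneg _
  · have h5 : (‖u‖ + ‖v‖) * (δ / 2 * (‖u‖ + ‖v‖)) ≤ (‖u‖ + ‖v‖) * ‖B (u + v)‖ := by
      calc (‖u‖ + ‖v‖) * (δ / 2 * (‖u‖ + ‖v‖)) = δ / 2 * (‖u‖ + ‖v‖) ^ 2 := by ring
        _ ≤ δ * (‖u‖ ^ 2 + ‖v‖ ^ 2) := by nlinarith
        _ ≤ ‖v - u‖ * ‖B (u + v)‖ := h2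
        _ ≤ _ := by gcongr
    exact (mul_le_mul_of_nonneg_left (norm_add_le u v) (half_pos hδ).le).trans
      (le_of_mul_le_mul_left h5 h0)

/-- The square root of the positive part of `A`. -/
noncomputable def sqrtPosPart (A : H →L[ℂ] H) : H →L[ℂ] H :=
  cfc (fun x : ℝ => √(max x 0)) A

theorem isSelfAdjoint_sqrtPosPart (A : H →L[ℂ] H) : IsSelfAdjoint (sqrtPosPart A) :=
  cfc_predicate _ A

theorem sqrtPosPart_neg {A : H →L[ℂ] H} (hA : IsSelfAdjoint A) :
    sqrtPosPart (-A) = cfc (fun x : ℝ => √(max (-x) 0)) A := by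
  rw [sqrtPosPart, ← cfc_comp_neg (fun x : ℝ => √(max x 0)) A]

theorem sqrtPosPart_mul_self_sub {A : H →L[ℂ] H} (hA : IsSelfAdjoint A) :
    sqrtPosPart A * sqrtPosPart A - sqrtPosPart (-A) * sqrtPosPart (-A) = A := by
  rw [sqrtPosPart_neg hA, sqrtPosPart, ← cfc_mul .., ← cfc_mul .., ← cfc_sub ..]
  conv_rhs => rw [← cfc_id ℝ A]
  refine cfc_congr fun x _ => ?_
  simp only [Real.mul_self_sqrt (le_max_right _ _), id]
  rcases le_total x 0 with h | h
  · rw [max_eq_right h, max_eq_left (neg_nonneg.2 h)]; ring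
  · rw [max_eq_left h, max_eq_right (neg_nonpos.2 h)]; ring

theorem sqrtPosPart_mul_sqrtPosPart_neg {A : H →L[ℂ] H} (hA : IsSelfAdjoint A) :
    sqrtPosPart A * sqrtPosPart (-A) = 0 := by
  rw [sqrtPosPart_neg hA, sqrtPosPart, ← cfc_mul .., ← cfc_zero (R := ℝ) (a := A)]
  refine cfc_congr fun x _ => ?_
  rcases le_total x 0 with h | h
  · simp [max_eq_right h]
  · simp [max_eq_right (neg_nonpos.2 h)]

theorem sqrtPosPart_neg_mul_sqrtPosPart {A : H →L[ℂ] H} (hA : IsSelfAdjoint A) :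
    sqrtPosPart (-A) * sqrtPosPart A = 0 := by
  simpa using sqrtPosPart_mul_sqrtPosPart_neg hA.neg

theorem apply_eq_sub {A : H →L[ℂ] H} (hA : IsSelfAdjoint A) (x : H) :
    A x = sqrtPosPart A (sqrtPosPart A x) - sqrtPosPart (-A) (sqrtPosPart (-A) x) := by
  conv_lhs => rw [← sqrtPosPart_mul_self_sub hA]
  rfl

theorem inner_apply_eq_sub {A : H →L[ℂ] H} (hA : IsSelfAdjoint A) (x y : H) :
    ⟪x, A y⟫_ℂ = ⟪sqrtPosPart A x, sqrtPosPart A y⟫_ℂ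
      - ⟪sqrtPosPart (-A) x, sqrtPosPart (-A) y⟫_ℂ := by
  rw [inner_map_comm (isSelfAdjoint_sqrtPosPart A), inner_map_comm (isSelfAdjoint_sqrtPosPart _),
    ← inner_sub_right, ← apply_eq_sub hA]

theorem sqrtPosPart_sqrtPosPart_neg {A : H →L[ℂ] H} (hA : IsSelfAdjoint A) (x : H) :
    sqrtPosPart A (sqrtPosPart (-A) x) = 0 :=
  DFunLike.congr_fun (sqrtPosPart_mul_sqrtPosPart_neg hA) x

theorem sqrtPosPart_neg_sqrtPosPart {A : H →L[ℂ] H} (hA : IsSelfAdjoint A) (x : H) :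
    sqrtPosPart (-A) (sqrtPosPart A x) = 0 :=
  DFunLike.congr_fun (sqrtPosPart_neg_mul_sqrtPosPart hA) x

theorem map_mem_orthogonal_ker {T : H →L[ℂ] H} (hT : IsSelfAdjoint T) (x : H) :
    T x ∈ T.kerᗮ := by
  refine (Submodule.mem_orthogonal _ _).2 fun y hy => ?_
  rw [← inner_map_comm hT, show T y = 0 from hy, inner_zero_left]

theorem closure_range_eq_orthogonal_ker {T : H →L[ℂ] H} (hT : IsSelfAdjoint T) :
    closure (Set.range T) = (T.kerᗮ : Set H) := by
  rw [T.orthogonal_ker, hT.adjoint_eq]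
  rfl

/-- On the closure of the range of the positive part, the negative part vanishes. -/
theorem sqrtPosPart_neg_eq_zero {A : H →L[ℂ] H} (hA : IsSelfAdjoint A) {x : H}
    (hx : x ∈ (sqrtPosPart A).kerᗮ) : sqrtPosPart (-A) x = 0 := by
  rw [← SetLike.mem_coe, ← closure_range_eq_orthogonal_ker (isSelfAdjoint_sqrtPosPart A)] at hx
  refine closure_minimal (t := {x | sqrtPosPart (-A) x = 0}) ?_
    (isClosed_eq (sqrtPosPart (-A)).continuous continuous_const) hx
  rintro _ ⟨y, rfl⟩
  exact sqrtPosPart_neg_sqrtPosPart hA y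

/-- If the square root of `A₊` is bounded below on the closure of its range, then this closure and
the kernel of `A₊` split `H`. -/
theorem HasPositiveSplitting.of_le_norm_sqrtPosPart {A : H →L[ℂ] H} (hA : IsSelfAdjoint A)
    {c : ℝ} (hc : 0 < c)
    (h : ∀ u ∈ (sqrtPosPart A).kerᗮ, c * ‖u‖ ^ 2 ≤ ‖sqrtPosPart A u‖ ^ 2) :
    HasPositiveSplitting A := by
  refine ⟨c, hc, (sqrtPosPart A).kerᗮ, (sqrtPosPart A).ker, Submodule.isClosed_orthogonal _,
    ?_, ?_, ?_, ?_⟩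
  · have : CompleteSpace (sqrtPosPart A).ker :=
      (sqrtPosPart A).isClosed_ker.completeSpace_coe
    rw [sup_comm]
    exact Submodule.sup_orthogonal_of_hasOrthogonalProjection
  · intro u hu v hv
    rw [inner_apply_eq_sub hA, show sqrtPosPart A v = 0 from hv, sqrtPosPart_neg_eq_zero hA hu]
    simp
  · intro u hu
    rw [inner_apply_eq_sub hA, sqrtPosPart_neg_eq_zero hA hu, inner_zero_left, sub_zero,
      re_inner_self_eq_norm_sq]
    exact h u hu
  · intro v hv
    rw [inner_apply_eq_sub hA, show sqrtPosPart A v = 0 from hv, inner_zero_left, zero_sub,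
      Complex.neg_re, re_inner_self_eq_norm_sq]
    exact neg_nonpos.2 (sq_nonneg _)

theorem HasRightSpectralGap.hasPositiveSplitting {A : H →L[ℂ] H} (hA : IsSelfAdjoint A)
    (h : HasRightSpectralGap A) : HasPositiveSplitting A := by
  obtain ⟨ε, hε, h⟩ := h
  set T := sqrtPosPart A with hTdef
  have hT : IsSelfAdjoint T := isSelfAdjoint_sqrtPosPart A
  have hspec : ∀ x ∈ spectrum ℝ A, x ≤ 0 ∨ ε ≤ x := by
    intro x hx
    by_contra! hcon
    have h1 : (x : ℂ) ∈ spectrum ℂ A := by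
      rw [← hA.spectrumRestricts.algebraMap_image]
      exact ⟨x, hx, rfl⟩
    exact h1 (h x ⟨hcon.1, hcon.2⟩)
  -- On the spectrum `x₊ (x₊ - ε) ≥ 0`, hence `T (T² - ε) T ≥ 0`.
  have hpos : 0 ≤ T * (T * T) * T - ε • (T * T) := by
    have : T * (T * T) * T - ε • (T * T) = cfc (fun x : ℝ => √(max x 0) *
        (√(max x 0) * √(max x 0)) * √(max x 0) - ε • (√(max x 0) * √(max x 0))) A := by
      rw [cfc_sub .., cfc_smul .., cfc_mul .., cfc_mul .., cfc_mul ..]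
      rfl
    rw [this]
    refine cfc_nonneg fun x hx => ?_
    rw [show ∀ a : ℝ, a * (a * a) * a - ε • (a * a) = (a * a) * (a * a - ε) by
      intro a; simp only [smul_eq_mul]; ring, Real.mul_self_sqrt (le_max_right _ _)]
    rcases hspec x hx with h | h
    · simp [max_eq_right h]
    · have : 0 ≤ x := hε.le.trans h
      rw [max_eq_left this]
      exact mul_nonneg this (sub_nonneg.2 h)
  refine HasPositiveSplitting.of_le_norm_sqrtPosPart hA hε fun u hu => ?_
  rw [← SetLike.mem_coe, ← closure_range_eq_orthogonal_ker hT] at hu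
  refine closure_minimal (t := {u | ε * ‖u‖ ^ 2 ≤ ‖T u‖ ^ 2}) ?_
    (isClosed_le (by fun_prop) (by fun_prop)) hu
  rintro _ ⟨y, rfl⟩
  have h1 := ((ContinuousLinearMap.nonneg_iff_isPositive _).1 hpos).re_inner_nonneg_right y
  have h2 : ⟪y, (T * (T * T) * T - ε • (T * T)) y⟫_ℂ
      = ⟪T (T y), T (T y)⟫_ℂ - (ε : ℂ) * ⟪T y, T y⟫_ℂ := by
    simp only [sub_apply, smul_apply, inner_sub_right, inner_map_comm hT]
    rw [← Complex.coe_smul, inner_smul_right]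
    rfl
  rw [h2] at h1
  have h3 : (⟪T (T y), T (T y)⟫_ℂ - (ε : ℂ) * ⟪T y, T y⟫_ℂ).re
      = ‖T (T y)‖ ^ 2 - ε * ‖T y‖ ^ 2 := by
    rw [Complex.sub_re, Complex.re_ofReal_mul, re_inner_self_eq_norm_sq, re_inner_self_eq_norm_sq]
  have h4 : 0 ≤ ‖T (T y)‖ ^ 2 - ε * ‖T y‖ ^ 2 := h3 ▸ h1
  exact sub_nonneg.1 h4

end Operators

/-! ### Fundamental symmetries and uniformly positive subspaces -/

section FundamentalSymmetry

variable {K : Type*} [NormedAddCommGroup K] [InnerProductSpace ℂ K]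

/-- A fundamental symmetry: a selfadjoint involution `J`.  It turns `K` into a Kreĭn space with
the indefinite inner product `⟪x, J y⟫`. -/
structure IsFundamentalSymmetry (J : K →L[ℂ] K) : Prop where
  inner_comm : ∀ x y, ⟪J x, y⟫_ℂ = ⟪x, J y⟫_ℂ
  involutive : ∀ x, J (J x) = x

/-- Uniform positivity of `L` for the indefinite inner product `⟪x, J y⟫`; the orthogonal
companion of `L` is the preimage under `J` of the Hilbert space complement of `L`. -/
def IsUniformlyPositiveFor (J : K →L[ℂ] K) (L : Submodule ℂ K) : Prop :=
  (IsClosed (L : Set K) ∧ L ⊔ Lᗮ.comap (J : K →ₗ[ℂ] K) = ⊤) ∧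
    ∀ x ∈ L, x ≠ 0 → 0 < (⟪x, J x⟫_ℂ).re

namespace IsFundamentalSymmetry

variable {J : K →L[ℂ] K}

theorem neg (hJ : IsFundamentalSymmetry J) : IsFundamentalSymmetry (-J) where
  inner_comm x y := by simp [hJ.inner_comm]
  involutive x := by simp [hJ.involutive]

theorem norm_map (hJ : IsFundamentalSymmetry J) (x : K) : ‖J x‖ = ‖x‖ := by
  have : ‖J x‖ ^ 2 = ‖x‖ ^ 2 := by
    rw [← re_inner_self_eq_norm_sq, hJ.inner_comm, hJ.involutive, re_inner_self_eq_norm_sq]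
  exact (pow_left_inj₀ (norm_nonneg _) (norm_nonneg _) two_ne_zero).1 this

theorem re_inner_le (hJ : IsFundamentalSymmetry J) (x : K) : (⟪x, J x⟫_ℂ).re ≤ ‖x‖ ^ 2 :=
  (re_inner_le_norm_mul_norm _ _).trans_eq (by rw [hJ.norm_map, sq])

theorem neg_re_inner_le (hJ : IsFundamentalSymmetry J) (x : K) :
    -(⟪x, J x⟫_ℂ).re ≤ ‖x‖ ^ 2 := by
  simpa using hJ.neg.re_inner_le x

theorem inner_conj (hJ : IsFundamentalSymmetry J) (x y : K) :
    conj ⟪x, J y⟫_ℂ = ⟪y, J x⟫_ℂ := by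
  rw [inner_conj_symm, hJ.inner_comm]

theorem inner_eq_zero_symm (hJ : IsFundamentalSymmetry J) {x y : K} (h : ⟪x, J y⟫_ℂ = 0) :
    ⟪y, J x⟫_ℂ = 0 := by
  rw [← hJ.inner_conj, h, map_zero]

/-- A subspace that is nonnegative and the range of a bounded `J`-orthogonal projection is
uniformly positive: if `m` is the projection of `J l`, then `⟪l, J m⟫ = ‖l‖²`, and the
Cauchy-Schwarz inequality for the indefinite inner product on `L` gives the bound. -/
theorem norm_sq_le_of_nonneg (hJ : IsFundamentalSymmetry J) {L : Submodule ℂ K}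
    (hL : ∀ l ∈ L, 0 ≤ (⟪l, J l⟫_ℂ).re) {C : ℝ} (hC : 0 < C)
    (hproj : ∀ x, ∃ m ∈ L, ‖m‖ ≤ C * ‖x‖ ∧ ∀ l ∈ L, ⟪l, J m⟫_ℂ = ⟪l, J x⟫_ℂ) :
    ∀ l ∈ L, ‖l‖ ^ 2 ≤ C ^ 2 * (⟪l, J l⟫_ℂ).re := by
  intro l hl
  obtain ⟨m, hm, hmn, hml⟩ := hproj (J l)
  have h1 : (⟪l, J m⟫_ℂ).re = ‖l‖ ^ 2 := by
    rw [hml l hl, hJ.involutive, re_inner_self_eq_norm_sq]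
  have h2 : (⟪m, J l⟫_ℂ).re = ‖l‖ ^ 2 := by
    rw [← hJ.inner_conj, Complex.conj_re, h1]
  have h3 : (⟪m, J m⟫_ℂ).re ≤ C ^ 2 * ‖l‖ ^ 2 := by
    refine (hJ.re_inner_le m).trans ?_
    rw [← mul_pow]
    rw [hJ.norm_map] at hmn
    gcongr
  -- Nonnegativity at `C² l - m`.
  have h4 := hL _ (L.sub_mem (L.smul_mem ((C ^ 2 : ℝ) : ℂ) hl) hm)
  simp only [map_sub, map_smul, inner_sub_left, inner_sub_right, inner_smul_left,
    inner_smul_right, Complex.sub_re, Complex.conj_ofReal, Complex.re_ofReal_mul, h1, h2] at h4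
  have h5 : 0 ≤ C ^ 2 * (C ^ 2 * (⟪l, J l⟫_ℂ).re - ‖l‖ ^ 2) := by nlinarith
  exact sub_nonneg.1 (nonneg_of_mul_nonneg_right h5 (by positivity))

end IsFundamentalSymmetry

/-- A complete subspace on which the indefinite inner product is bounded below is the range of a
bounded `J`-orthogonal projection. -/
theorem exists_bounded_projection {J : K →L[ℂ] K} {L : Submodule ℂ K} [CompleteSpace L]
    {c : ℝ} (hc : 0 < c) (hL : ∀ l ∈ L, c * ‖l‖ ^ 2 ≤ (⟪l, J l⟫_ℂ).re) :
    ∃ Q : K →L[ℂ] K, (∀ x, Q x ∈ L) ∧ ∀ x, ∀ l ∈ L, ⟪l, J (Q x)⟫_ℂ = ⟪l, J x⟫_ℂ := by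
  set G : L →L[ℂ] L := L.orthogonalProjectionOnto ∘L J ∘L L.subtypeL with hG
  have hinner : ∀ (l : L) (y : K), ⟪l, L.orthogonalProjectionOnto y⟫_ℂ = ⟪(l : K), y⟫_ℂ :=
    fun l y => L.inner_orthogonalProjectionOnto_eq_of_mem_left l y
  have hunit : IsUnit G := by
    refine ContinuousLinearMap.isUnit_of_forall_le_norm_inner_map G (c := ⟨c, hc.le⟩) hc ?_
    intro l
    rw [norm_inner_symm]
    have h := hL l l.2
    have h2 : ⟪l, G l⟫_ℂ = ⟪(l : K), J l⟫_ℂ := hinner l (J l)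
    rw [h2]
    calc ‖l‖ ^ 2 * c = c * ‖(l : K)‖ ^ 2 := by rw [mul_comm]; rfl
      _ ≤ _ := h.trans (Complex.re_le_norm _)
  obtain ⟨g, hg⟩ := hunit
  refine ⟨L.subtypeL ∘L (↑g⁻¹ : L →L[ℂ] L) ∘L L.orthogonalProjectionOnto ∘L J,
    fun x => Subtype.property _, fun x l hl => ?_⟩
  have h1 : G ((↑g⁻¹ : L →L[ℂ] L) (L.orthogonalProjectionOnto (J x)))
      = L.orthogonalProjectionOnto (J x) := by
    rw [← hg]
    exact DFunLike.congr_fun (Units.mul_inv g) _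
  have h2 := congrArg (fun y => ⟪(⟨l, hl⟩ : L), y⟫_ℂ) h1
  exact (hinner ⟨l, hl⟩ _).symm.trans (h2.trans (hinner ⟨l, hl⟩ _))

theorem eq_zero_of_inner_map_self_eq_zero {J : K →L[ℂ] K} {L : Submodule ℂ K} {c : ℝ} (hc : 0 < c)
    (hL : ∀ l ∈ L, c * ‖l‖ ^ 2 ≤ (⟪l, J l⟫_ℂ).re) {l : K} (hl : l ∈ L)
    (h : ⟪l, J l⟫_ℂ = 0) : l = 0 := by
  have := hL l hl
  rw [h, Complex.zero_re] at this
  have h2 : ‖l‖ ^ 2 ≤ 0 := by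
    by_contra! hcon
    exact absurd this (not_le.2 (mul_pos hc hcon))
  exact norm_eq_zero.1 (pow_eq_zero_iff two_ne_zero |>.1 (le_antisymm h2 (sq_nonneg _)))

namespace IsUniformlyPositiveFor

variable {J : K →L[ℂ] K} {L : Submodule ℂ K}

theorem exists_add (hL : IsUniformlyPositiveFor J L) (x : K) :
    ∃ l ∈ L, ∃ n, (∀ y ∈ L, ⟪y, J n⟫_ℂ = 0) ∧ l + n = x := by
  obtain ⟨l, hl, n, hn, h⟩ := Submodule.mem_sup.1
    (hL.1.2 ▸ Submodule.mem_top : x ∈ L ⊔ Lᗮ.comap (J : K →ₗ[ℂ] K))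
  exact ⟨l, hl, n, fun y hy => (Submodule.mem_orthogonal _ _).1 hn y hy, h⟩

theorem isCompl (hL : IsUniformlyPositiveFor J L) :
    IsCompl L (Lᗮ.comap (J : K →ₗ[ℂ] K)) := by
  refine ⟨Submodule.disjoint_def.2 fun x hx hx' => ?_, codisjoint_iff.2 hL.1.2⟩
  by_contra hne
  have h1 := hL.2 x hx hne
  rw [show ⟪x, J x⟫_ℂ = 0 from (Submodule.mem_orthogonal _ _).1 hx' x hx] at h1
  exact lt_irrefl _ h1

theorem exists_mul_norm_sq_le [CompleteSpace K] (hJ : IsFundamentalSymmetry J)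
    (hL : IsUniformlyPositiveFor J L) :
    ∃ c : ℝ, 0 < c ∧ ∀ l ∈ L, c * ‖l‖ ^ 2 ≤ (⟪l, J l⟫_ℂ).re := by
  have hclosed : IsClosed ((Lᗮ.comap (J : K →ₗ[ℂ] K) : Submodule ℂ K) : Set K) :=
    (Submodule.isClosed_orthogonal L).preimage J.continuous
  have htop := Submodule.IsCompl.isTopCompl_of_isClosed hL.isCompl hL.1.1 hclosed
  set P : K →L[ℂ] L := L.projectionOntoL _ htop with hP
  have hnonneg : ∀ l ∈ L, 0 ≤ (⟪l, J l⟫_ℂ).re := by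
    intro l hl
    rcases eq_or_ne l 0 with rfl | h
    · simp
    · exact (hL.2 l hl h).le
  have hC : 0 < ‖P‖ + 1 := by positivity
  have := hJ.norm_sq_le_of_nonneg hnonneg hC fun x => by
    refine ⟨P x, (P x).2, ?_, fun l hl => ?_⟩
    · refine (P.le_opNorm x).trans ?_
      gcongr
      linarith
    · obtain ⟨l', hl', n, hn, rfl⟩ := hL.exists_add x
      have h1 : P l' = ⟨l', hl'⟩ := by
        simpa [hP] using Submodule.projectionOnto_apply_left hL.isCompl ⟨l', hl'⟩
      have h2 : P n = 0 := by
        have : n ∈ Lᗮ.comap (J : K →ₗ[ℂ] K) := (Submodule.mem_orthogonal _ _).2 hn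
        simpa [hP] using this
      rw [map_add P, h1, h2, add_zero, map_add, inner_add_right, hn l hl, add_zero]
  refine ⟨((‖P‖ + 1) ^ 2)⁻¹, by positivity, fun l hl => ?_⟩
  rw [inv_mul_le_iff₀ (by positivity)]
  exact this l hl

end IsUniformlyPositiveFor

/-- The indefinite inner product is nonpositive on the orthogonal companion of a maximal uniformly
positive subspace: a companion vector with `⟪m, J m⟫ > 0` could be adjoined to the subspace. -/
theorem re_inner_nonpos_of_maximal {J : K →L[ℂ] K} (hJ : IsFundamentalSymmetry J)
    {L : Submodule ℂ K} (hL : Maximal (IsUniformlyPositiveFor J) L) {m : K}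
    (hm : ∀ y ∈ L, ⟪y, J m⟫_ℂ = 0) : (⟪m, J m⟫_ℂ).re ≤ 0 := by
  by_contra! hpos
  have hreal : ⟪m, J m⟫_ℂ ≠ 0 := fun h => by simp [h] at hpos
  have hupos : IsUniformlyPositiveFor J (L ⊔ Submodule.span ℂ {m}) := by
    refine ⟨⟨Submodule.isClosed_sup_finiteDimensional _ _ hL.1.1.1, ?_⟩, ?_⟩
    · rw [eq_top_iff]
      rintro x -
      obtain ⟨l, hl, n, hn, rfl⟩ := hL.1.exists_add x
      set a := ⟪m, J n⟫_ℂ / ⟪m, J m⟫_ℂ with ha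
      refine Submodule.mem_sup.2 ⟨l + a • m, Submodule.mem_sup.2 ⟨l, hl, a • m,
        Submodule.smul_mem _ _ (Submodule.mem_span_singleton_self m), rfl⟩, n - a • m, ?_, by abel⟩
      refine (Submodule.mem_orthogonal _ _).2 fun y hy => ?_
      obtain ⟨l', hl', k, hk, rfl⟩ := Submodule.mem_sup.1 hy
      obtain ⟨b, rfl⟩ := Submodule.mem_span_singleton.1 hk
      simp only [ContinuousLinearMap.coe_coe, map_sub, map_smul, inner_add_left, inner_sub_right,
        inner_smul_left, inner_smul_right, hn l' hl', hm l' hl', ha]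
      field_simp
      ring
    · intro x hx hx0
      obtain ⟨l, hl, k, hk, rfl⟩ := Submodule.mem_sup.1 hx
      obtain ⟨b, rfl⟩ := Submodule.mem_span_singleton.1 hk
      have h1 : (⟪l + b • m, J (l + b • m)⟫_ℂ).re
          = (⟪l, J l⟫_ℂ).re + ‖b‖ ^ 2 * (⟪m, J m⟫_ℂ).re := by
        simp only [map_add, map_smul, inner_add_left, inner_add_right, inner_smul_left,
          inner_smul_right, hm l hl, hJ.inner_eq_zero_symm (hm l hl), mul_zero, add_zero, zero_add]
        rw [← mul_assoc, Complex.mul_conj', Complex.add_re, ← Complex.ofReal_pow,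
          Complex.re_ofReal_mul]
      rw [h1]
      rcases eq_or_ne b 0 with rfl | hb
      · have := hL.1.2 l hl (by simpa using hx0)
        simpa using this
      · have h2 : 0 ≤ (⟪l, J l⟫_ℂ).re := by
          rcases eq_or_ne l 0 with rfl | h
          · simp
          · exact (hL.1.2 l hl h).le
        have : 0 < ‖b‖ ^ 2 * (⟪m, J m⟫_ℂ).re := by
          have := norm_pos_iff.2 hb
          positivity
        linarith
  have hmem : m ∈ L := hL.2 hupos le_sup_left
    (Submodule.mem_sup_right (Submodule.mem_span_singleton_self m))
  exact hreal (hm m hmem)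

end FundamentalSymmetry

/-! ### Splittings and induced Kreĭn spaces -/

section Induced

variable {H K K' : Type*} [NormedAddCommGroup H] [InnerProductSpace ℂ H]
  [NormedAddCommGroup K] [InnerProductSpace ℂ K] [NormedAddCommGroup K'] [InnerProductSpace ℂ K']

/-- The Kreĭn space with fundamental symmetry `J` and the operator `P` form a Kreĭn space induced
by `A`. -/
structure IsInduced (A : H →L[ℂ] H) (J : K →L[ℂ] K) (P : H →L[ℂ] K) : Prop where
  symm : IsFundamentalSymmetry J
  denseRange : DenseRange P
  inner_map : ∀ x y, ⟪P x, J (P y)⟫_ℂ = ⟪x, A y⟫_ℂ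

namespace IsInduced

variable {A : H →L[ℂ] H} {J : K →L[ℂ] K} {P : H →L[ℂ] K} {J' : K' →L[ℂ] K'} {P' : H →L[ℂ] K'}

theorem neg (h : IsInduced A J P) : IsInduced (-A) (-J) P where
  symm := h.symm.neg
  denseRange := h.denseRange
  inner_map x y := by simp [h.inner_map]

theorem mul_norm_sq_le_norm_map_sq (h : IsInduced A J P) {c : ℝ} {u : H}
    (hu : c * ‖u‖ ^ 2 ≤ (⟪u, A u⟫_ℂ).re) : c * ‖u‖ ^ 2 ≤ ‖P u‖ ^ 2 := by
  rw [← h.inner_map] at hu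
  exact hu.trans (h.symm.re_inner_le _)

variable [CompleteSpace H]

/-- A positive splitting of `H` is carried by `P` to a splitting of `K`: the image `L` of `M` is
closed and uniformly positive, `K` is projected onto `L` by a bounded `J`-orthogonal projection `Q`,
and the indefinite inner product is nonpositive on the kernel of `Q`, because the image of `N` is
dense there. -/
theorem exists_projection_map (h : IsInduced A J P) {c : ℝ} (hc : 0 < c) {M N : Submodule ℂ H}
    (hMc : IsClosed (M : Set H)) (hMN : M ⊔ N = ⊤) (hort : ∀ u ∈ M, ∀ v ∈ N, ⟪u, A v⟫_ℂ = 0)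
    (hM : ∀ u ∈ M, c * ‖u‖ ^ 2 ≤ (⟪u, A u⟫_ℂ).re) (hN : ∀ v ∈ N, (⟪v, A v⟫_ℂ).re ≤ 0) :
    IsClosed ((M.map (P : H →ₗ[ℂ] K) : Submodule ℂ K) : Set K) ∧ ∃ Q : K →L[ℂ] K,
      (∀ x, Q x ∈ M.map (P : H →ₗ[ℂ] K)) ∧
      (∀ x, ∀ l ∈ M.map (P : H →ₗ[ℂ] K), ⟪l, J (Q x)⟫_ℂ = ⟪l, J x⟫_ℂ) ∧
      (∀ l ∈ M.map (P : H →ₗ[ℂ] K), l ≠ 0 → 0 < (⟪l, J l⟫_ℂ).re) ∧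
      (∀ u ∈ M, ∀ v ∈ N, Q (P (u + v)) = P u) ∧
      ∀ x, (⟪x - Q x, J (x - Q x)⟫_ℂ).re ≤ 0 := by
  have hMcomp : CompleteSpace M := hMc.completeSpace_coe
  have hanti : AntilipschitzWith (Real.toNNReal (√c)⁻¹) (P ∘L M.subtypeL) := by
    refine ContinuousLinearMap.antilipschitz_of_bound _ fun u => ?_
    have hs := Real.sqrt_pos.2 hc
    rw [Real.coe_toNNReal _ (inv_pos.2 hs).le, inv_mul_eq_div, le_div_iff₀ hs]
    have h1 := h.mul_norm_sq_le_norm_map_sq (hM u u.2)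
    refine (pow_le_pow_iff_left₀ (by positivity) (norm_nonneg _) two_ne_zero).1 ?_
    rw [mul_pow, Real.sq_sqrt hc.le, mul_comm]
    exact h1
  have hset : ((M.map (P : H →ₗ[ℂ] K) : Submodule ℂ K) : Set K)
      = Set.range (P ∘L M.subtypeL) := by
    ext x; simp
  have hLcomplete : IsComplete ((M.map (P : H →ₗ[ℂ] K) : Submodule ℂ K) : Set K) := by
    rw [hset]
    exact hanti.isComplete_range (P ∘L M.subtypeL).uniformContinuous
  have hLcomp : CompleteSpace (M.map (P : H →ₗ[ℂ] K)) := hLcomplete.completeSpace_coe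
  obtain ⟨c', hc', hL⟩ : ∃ c' : ℝ, 0 < c' ∧
      ∀ l ∈ M.map (P : H →ₗ[ℂ] K), c' * ‖l‖ ^ 2 ≤ (⟪l, J l⟫_ℂ).re := by
    refine ⟨c / (‖P‖ + 1) ^ 2, by positivity, ?_⟩
    rintro _ ⟨u, hu, rfl⟩
    have h1 : ‖P u‖ ≤ (‖P‖ + 1) * ‖u‖ := (P.le_opNorm u).trans (by gcongr; linarith)
    calc c / (‖P‖ + 1) ^ 2 * ‖P u‖ ^ 2 ≤ c / (‖P‖ + 1) ^ 2 * ((‖P‖ + 1) * ‖u‖) ^ 2 := by gcongr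
      _ = c * ‖u‖ ^ 2 := by field_simp
      _ ≤ (⟪u, A u⟫_ℂ).re := hM u hu
      _ = _ := by rw [← h.inner_map]; rfl
  obtain ⟨Q, hQmem, hQ⟩ := exists_bounded_projection hc' hL
  have hQadd : ∀ u ∈ M, ∀ v ∈ N, Q (P (u + v)) = P u := by
    intro u hu v hv
    have hmem : Q (P (u + v)) - P u ∈ M.map (P : H →ₗ[ℂ] K) :=
      Submodule.sub_mem _ (hQmem _) ⟨u, hu, rfl⟩
    refine sub_eq_zero.1 (eq_zero_of_inner_map_self_eq_zero hc' hL hmem ?_)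
    rw [map_sub, inner_sub_right, hQ _ _ hmem, ← inner_sub_right, ← map_sub, ← map_sub,
      add_sub_cancel_left]
    obtain ⟨w, hw, hw'⟩ := hmem
    rw [← hw']
    exact (h.inner_map w v).trans (hort w hw v hv)
  refine ⟨hLcomplete.isClosed, Q, hQmem, hQ, fun l hl hl0 => ?_, hQadd, fun x => ?_⟩
  · have := norm_pos_iff.2 hl0
    exact lt_of_lt_of_le (by positivity) (hL l hl)
  · refine h.denseRange.induction_on (p := fun x => (⟪x - Q x, J (x - Q x)⟫_ℂ).re ≤ 0) x
      (isClosed_le (by fun_prop) continuous_const) fun y => ?_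
    obtain ⟨u, hu, v, hv, rfl⟩ := Submodule.mem_sup.1 (hMN ▸ Submodule.mem_top : y ∈ M ⊔ N)
    have h1 : P (u + v) - Q (P (u + v)) = P v := by
      rw [hQadd u hu v hv, map_add, add_sub_cancel_left]
    change (⟪P (u + v) - Q (P (u + v)), J (P (u + v) - Q (P (u + v)))⟫_ℂ).re ≤ 0
    rw [h1, h.inner_map]
    exact hN v hv

theorem exists_maximal_of_hasPositiveSplitting (h : IsInduced A J P)
    (hA : HasPositiveSplitting A) :
    ∃ L : Submodule ℂ K, Maximal (IsUniformlyPositiveFor J) L ∧ (L : Set K) ⊆ Set.range P := by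
  obtain ⟨c, hc, M, N, hMc, hMN, hort, hM, hN⟩ := hA
  obtain ⟨hcl, Q, hQmem, hQ, hpos, -, hneg⟩ := h.exists_projection_map hc hMc hMN hort hM hN
  refine ⟨M.map (P : H →ₗ[ℂ] K), ⟨⟨⟨hcl, ?_⟩, hpos⟩, fun L' hL' hle x hx => ?_⟩, ?_⟩
  · refine eq_top_iff.2 fun x _ => Submodule.mem_sup.2 ⟨Q x, hQmem x, x - Q x, ?_, by abel⟩
    refine (Submodule.mem_orthogonal _ _).2 fun y hy => ?_
    rw [ContinuousLinearMap.coe_coe, map_sub, inner_sub_right, hQ x y hy, sub_self]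
  · by_contra hne
    have h1 : x - Q x ≠ 0 := fun h0 => hne (sub_eq_zero.1 h0 ▸ hQmem x)
    exact not_lt.2 (hneg x) (hL'.2 _ (L'.sub_mem hx (hle (hQmem x))) h1)
  · rintro _ ⟨u, -, rfl⟩
    exact ⟨u, rfl⟩

/-- In the presence of a positive splitting, the norm of `P (u + v)` is determined, up to
constants, by the operator `A`. -/
theorem exists_norm_map_sq_equiv (h : IsInduced A J P) {c : ℝ} (hc : 0 < c) {M N : Submodule ℂ H}
    (hMc : IsClosed (M : Set H)) (hMN : M ⊔ N = ⊤) (hort : ∀ u ∈ M, ∀ v ∈ N, ⟪u, A v⟫_ℂ = 0)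
    (hM : ∀ u ∈ M, c * ‖u‖ ^ 2 ≤ (⟪u, A u⟫_ℂ).re) (hN : ∀ v ∈ N, (⟪v, A v⟫_ℂ).re ≤ 0) :
    ∃ C₁ C₂ : ℝ, 0 ≤ C₁ ∧ 0 ≤ C₂ ∧ ∀ u ∈ M, ∀ v ∈ N,
      ‖P (u + v)‖ ^ 2 ≤ C₁ * ((⟪u, A u⟫_ℂ).re - (⟪v, A v⟫_ℂ).re) ∧
      (⟪u, A u⟫_ℂ).re - (⟪v, A v⟫_ℂ).re ≤ C₂ * ‖P (u + v)‖ ^ 2 := by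
  obtain ⟨-, Q, hQmem, hQ, -, hQadd, hneg⟩ := h.exists_projection_map hc hMc hMN hort hM hN
  have hC : 0 < 1 + ‖Q‖ := by positivity
  have hQn : ∀ x, ‖x - Q x‖ ≤ (1 + ‖Q‖) * ‖x‖ := fun x => by
    calc ‖x - Q x‖ ≤ ‖x‖ + ‖Q x‖ := norm_sub_le _ _
      _ ≤ ‖x‖ + ‖Q‖ * ‖x‖ := by gcongr; exact Q.le_opNorm x
      _ = _ := by ring
  have hort0 : ∀ x y, ⟪Q x, J (y - Q y)⟫_ℂ = 0 := fun x y => by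
    rw [map_sub, inner_sub_right, hQ y _ (hQmem x), sub_self]
  -- The companion of the range of `Q` is uniformly negative.
  have hN' : ∀ v ∈ N, ‖P v‖ ^ 2 ≤ (1 + ‖Q‖) ^ 2 * -(⟪v, A v⟫_ℂ).re := by
    intro v hv
    have h0 : Q (P v) = 0 := by simpa using hQadd 0 M.zero_mem v hv
    have key := h.symm.neg.norm_sq_le_of_nonneg (L := Q.ker) ?_ hC ?_ (P v) h0
    · simpa [h.inner_map] using key
    · intro l hl
      have := hneg l
      rw [show Q l = 0 from hl, sub_zero] at this
      simpa using this
    · intro x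
      refine ⟨x - Q x, ?_, hQn x, fun l hl => ?_⟩
      · obtain ⟨w, hw, hw'⟩ := hQmem x
        have : Q (Q x) = Q x := by
          rw [← hw']
          simpa using hQadd w hw 0 N.zero_mem
        exact LinearMap.mem_ker.2 (by simp [this])
      · have h1 : ⟪l, J (Q x)⟫_ℂ = 0 := by
          refine h.symm.inner_eq_zero_symm ?_
          have := hort0 x l
          rwa [show Q l = 0 from hl, sub_zero] at this
        simp [h1]
  have hM' : ∀ u ∈ M, ‖P u‖ ^ 2 ≤ ‖P‖ ^ 2 / c * (⟪u, A u⟫_ℂ).re := by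
    intro u hu
    calc ‖P u‖ ^ 2 ≤ (‖P‖ * ‖u‖) ^ 2 := by gcongr; exact P.le_opNorm u
      _ = ‖P‖ ^ 2 / c * (c * ‖u‖ ^ 2) := by field_simp
      _ ≤ _ := by gcongr; exact hM u hu
  refine ⟨2 * (‖P‖ ^ 2 / c + (1 + ‖Q‖) ^ 2), ‖Q‖ ^ 2 + (1 + ‖Q‖) ^ 2, by positivity,
    by positivity, fun u hu v hv => ⟨?_, ?_⟩⟩
  · have h1 : ‖P (u + v)‖ ^ 2 ≤ 2 * (‖P u‖ ^ 2 + ‖P v‖ ^ 2) := by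
      have : ‖P (u + v)‖ ≤ ‖P u‖ + ‖P v‖ := by rw [map_add]; exact norm_add_le _ _
      nlinarith [sq_nonneg (‖P u‖ - ‖P v‖), norm_nonneg (P (u + v))]
    have h2 := hM' u hu
    have h3 := hN' v hv
    have h4 : 0 ≤ (⟪u, A u⟫_ℂ).re := le_trans (by positivity) (hM u hu)
    have h5 : 0 ≤ -(⟪v, A v⟫_ℂ).re := neg_nonneg.2 (hN v hv)
    have h6 : 0 ≤ ‖P‖ ^ 2 / c := by positivity
    nlinarith [mul_nonneg h6 h5, mul_nonneg (sq_nonneg (1 + ‖Q‖)) h4]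
  · have e1 : P u = Q (P (u + v)) := (hQadd u hu v hv).symm
    have e2 : P v = P (u + v) - Q (P (u + v)) := by
      rw [← e1, map_add, add_sub_cancel_left]
    have h1 : (⟪u, A u⟫_ℂ).re ≤ ‖Q‖ ^ 2 * ‖P (u + v)‖ ^ 2 := by
      rw [← h.inner_map, ← mul_pow]
      refine (h.symm.re_inner_le _).trans ?_
      rw [e1]
      gcongr
      exact Q.le_opNorm _
    have h2 : -(⟪v, A v⟫_ℂ).re ≤ (1 + ‖Q‖) ^ 2 * ‖P (u + v)‖ ^ 2 := by
      rw [← h.inner_map, ← mul_pow]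
      refine (h.symm.neg_re_inner_le _).trans ?_
      rw [e2]
      gcongr
      exact hQn _
    linarith

theorem exists_norm_map_le (h : IsInduced A J P) (h' : IsInduced A J' P')
    (hA : HasPositiveSplitting A) : ∃ C : ℝ, ∀ x, ‖P' x‖ ≤ C * ‖P x‖ := by
  obtain ⟨c, hc, M, N, hMc, hMN, hort, hM, hN⟩ := hA
  obtain ⟨_, C₂, -, hC₂, hP⟩ := h.exists_norm_map_sq_equiv hc hMc hMN hort hM hN
  obtain ⟨C₁, _, hC₁, -, hP'⟩ := h'.exists_norm_map_sq_equiv hc hMc hMN hort hM hN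
  refine ⟨√(C₁ * C₂), fun x => ?_⟩
  obtain ⟨u, hu, v, hv, rfl⟩ := Submodule.mem_sup.1 (hMN ▸ Submodule.mem_top : x ∈ M ⊔ N)
  refine (pow_le_pow_iff_left₀ (norm_nonneg _) (by positivity) two_ne_zero).1 ?_
  rw [mul_pow, Real.sq_sqrt (by positivity), mul_assoc]
  exact (hP' u hu v hv).1.trans (by gcongr; exact (hP u hu v hv).2)

/-- A maximal uniformly positive subspace `L` in the range of `P` yields a positive splitting:
`M` is the part of the preimage of `L` orthogonal to the kernel of `P`, on which `P` is bounded
below by the open mapping theorem, and `N` is the preimage of the companion of `L`. -/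
theorem hasPositiveSplitting_of_maximal [CompleteSpace K] (h : IsInduced A J P)
    {L : Submodule ℂ K} (hL : Maximal (IsUniformlyPositiveFor J) L)
    (hLP : (L : Set K) ⊆ Set.range P) : HasPositiveSplitting A := by
  obtain ⟨c, hc, hcL⟩ := hL.1.exists_mul_norm_sq_le h.symm
  set M : Submodule ℂ H := L.comap (P : H →ₗ[ℂ] K) ⊓ P.kerᗮ with hMdef
  have hMc : IsClosed (M : Set H) :=
    (hL.1.1.1.preimage P.continuous).inter (Submodule.isClosed_orthogonal _)
  have hMcomp : CompleteSpace M := hMc.completeSpace_coe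
  have hkercomp : CompleteSpace P.ker := P.isClosed_ker.completeSpace_coe
  have hlift : ∀ l ∈ L, ∃ u ∈ M, P u = l := by
    intro l hl
    obtain ⟨x, rfl⟩ := hLP hl
    obtain ⟨k, hk, u, hu, rfl⟩ := Submodule.mem_sup.1
      (P.ker.sup_orthogonal_of_hasOrthogonalProjection ▸ Submodule.mem_top : x ∈ P.ker ⊔ P.kerᗮ)
    have h1 : P (k + u) = P u := by rw [map_add, show P k = 0 from hk, zero_add]
    exact ⟨u, ⟨by simpa [h1] using hl, hu⟩, h1.symm⟩
  have hrange : Set.range (P ∘L M.subtypeL) = L := by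
    ext l
    constructor
    · rintro ⟨u, rfl⟩
      exact u.2.1
    · intro hl
      obtain ⟨u, hu, rfl⟩ := hlift l hl
      exact ⟨⟨u, hu⟩, rfl⟩
  have hinj : Function.Injective (P ∘L M.subtypeL) := by
    refine (injective_iff_map_eq_zero _).2 fun u hu => ?_
    have h1 : (u : H) ∈ P.ker := hu
    have h2 : ⟪(u : H), (u : H)⟫_ℂ = 0 := (Submodule.mem_orthogonal _ _).1 u.2.2 u h1
    exact Subtype.ext (inner_self_eq_zero.1 h2)
  obtain ⟨κ, hκ⟩ := ContinuousLinearMap.antilipschitz_of_injective_of_isClosed_range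
    (P ∘L M.subtypeL) hinj (by rw [hrange]; exact hL.1.1.1)
  refine ⟨c / (κ + 1) ^ 2, by positivity, M,
    (Lᗮ.comap (J : K →ₗ[ℂ] K)).comap (P : H →ₗ[ℂ] K), hMc, ?_, ?_, ?_, ?_⟩
  · refine eq_top_iff.2 fun x _ => ?_
    obtain ⟨l, hl, n, hn, hx⟩ := hL.1.exists_add (P x)
    obtain ⟨u, hu, rfl⟩ := hlift l hl
    refine Submodule.mem_sup.2 ⟨u, hu, x - u, ?_, by abel⟩
    refine (Submodule.mem_orthogonal _ _).2 fun y hy => ?_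
    have : P (x - u) = n := by rw [map_sub, ← hx, add_sub_cancel_left]
    exact (congrArg (fun z => ⟪y, J z⟫_ℂ) this).trans (hn y hy)
  · intro u hu v hv
    rw [← h.inner_map]
    exact (Submodule.mem_orthogonal _ _).1 hv (P u) hu.1
  · intro u hu
    have h1 : ‖u‖ ≤ (κ + 1) * ‖P u‖ := by
      have h2 := hκ.le_mul_norm (map_zero _) (⟨u, hu⟩ : M)
      refine (show ‖u‖ ≤ κ * ‖P u‖ from h2).trans ?_
      gcongr
      linarith
    rw [← h.inner_map]
    refine le_trans ?_ (hcL _ hu.1)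
    calc c / (κ + 1) ^ 2 * ‖u‖ ^ 2 ≤ c / (κ + 1) ^ 2 * ((κ + 1) * ‖P u‖) ^ 2 := by gcongr
      _ = c * ‖P u‖ ^ 2 := by field_simp
  · intro v hv
    rw [← h.inner_map]
    exact re_inner_nonpos_of_maximal h.symm hL fun y hy => (Submodule.mem_orthogonal _ _).1 hv y hy

end IsInduced

end Induced

/-! ### Kreĭn spaces from fundamental symmetries, and existence -/

section Symmetry

variable {K : Type u} [NormedAddCommGroup K] [InnerProductSpace ℂ K] [CompleteSpace K]

/-- The Kreĭn space with indefinite inner product `⟪x, J y⟫`; the eigenspaces of `J` for `1` and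
`-1` form a fundamental decomposition. -/
noncomputable abbrev IsFundamentalSymmetry.kreinSpace {J : K →L[ℂ] K}
    (hJ : IsFundamentalSymmetry J) : KreinSpace K where
  form := (innerₛₗ ℂ : K →ₗ⋆[ℂ] K →ₗ[ℂ] ℂ).compl₂ (J : K →ₗ[ℂ] K)
  form_conj_symm x y := hJ.inner_conj x y
  exists_fundamental_decomposition := by
    have hp : ∀ x : K, x ∈ (J - 1).ker ↔ J x = x := fun x => by
      simp [LinearMap.mem_ker, sub_eq_zero]
    have hm : ∀ x : K, x ∈ (J + 1).ker ↔ J x = -x := fun x => by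
      simp [LinearMap.mem_ker, add_eq_zero_iff_eq_neg]
    have hort : ∀ x, J x = x → ∀ y, J y = -y → ⟪x, y⟫_ℂ = 0 := by
      intro x hx y hy
      have h := hJ.inner_comm x y
      rw [hx, hy, inner_neg_right] at h
      exact self_eq_neg.1 h
    refine ⟨(J - 1).ker, (J + 1).ker, ⟨?_, ?_⟩, ?_, ?_⟩
    · refine Submodule.disjoint_def.2 fun x hx hx' => ?_
      rw [hp] at hx
      rw [hm, hx] at hx'
      rw [eq_neg_iff_add_eq_zero, ← two_smul ℂ] at hx'
      exact (smul_eq_zero.1 hx').resolve_left two_ne_zero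
    · refine codisjoint_iff.2 (eq_top_iff.2 fun x _ => Submodule.mem_sup.2
        ⟨(1 / 2 : ℂ) • (x + J x), ?_, (1 / 2 : ℂ) • (x - J x), ?_, ?_⟩)
      · rw [hp, map_smul, map_add, hJ.involutive, add_comm]
      · rw [hm, map_smul, map_sub, hJ.involutive, ← smul_neg, neg_sub]
      · rw [← smul_add, add_add_sub_cancel, ← two_smul ℂ x, smul_smul]
        norm_num
    · intro x hx y hy
      rw [hp] at hx
      rw [hm] at hy
      change ⟪x, J y⟫_ℂ = 0
      rw [hy, inner_neg_right, hort x hx y hy, neg_zero]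
    · intro xp hxp xm hxm yp hyp ym hym
      rw [hp] at hxp hyp
      rw [hm] at hxm hym
      change ⟪xp + xm, yp + ym⟫_ℂ = ⟪xp, J yp⟫_ℂ - ⟪xm, J ym⟫_ℂ
      have h1 := hort xp hxp ym hym
      have h2 : ⟪xm, yp⟫_ℂ = 0 := by rw [← inner_conj_symm, hort yp hyp xm hxm, map_zero]
      rw [hyp, hym, inner_add_left, inner_add_right, inner_add_right, h1, h2, inner_neg_right]
      ring

theorem exists_fundamentalSymmetry (K : Type u) [NormedAddCommGroup K] [InnerProductSpace ℂ K]
    [CompleteSpace K] [KreinSpace K] :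
    ∃ J : K →L[ℂ] K, IsFundamentalSymmetry J ∧ ∀ x y : K, KreinSpace.form x y = ⟪x, J y⟫_ℂ := by
  obtain ⟨Kp, Km, hc, hort, hinner⟩ := KreinSpace.exists_fundamental_decomposition (K := K)
  have hort' : ∀ x ∈ Km, ∀ y ∈ Kp, KreinSpace.form x y = 0 := fun x hx y hy => by
    rw [← KreinSpace.form_conj_symm, hort y hy x hx, map_zero]
  -- `J` is the identity on `Kp` and minus the identity on `Km`.
  set p : K →ₗ[ℂ] K := Kp.subtype ∘ₗ Kp.projectionOnto Km hc with hp
  set J₀ : K →ₗ[ℂ] K := (2 : ℂ) • p - LinearMap.id with hJ₀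
  have happ : ∀ x ∈ Kp, ∀ y ∈ Km, J₀ (x + y) = x - y := by
    intro x hx y hy
    have h1 : p (x + y) = x := by
      have hx' := Submodule.projectionOnto_apply_left hc ⟨x, hx⟩
      have hy' := Submodule.projectionOnto_apply_right hc ⟨y, hy⟩
      simp only [hp, LinearMap.comp_apply, map_add]
      rw [show Kp.projectionOnto Km hc x = ⟨x, hx⟩ from hx',
        show Kp.projectionOnto Km hc y = 0 from hy']
      simp
    rw [hJ₀, LinearMap.sub_apply, LinearMap.smul_apply, h1, LinearMap.id_apply, two_smul]
    abel
  have hdec : ∀ x : K, ∃ y ∈ Kp, ∃ z ∈ Km, y + z = x := fun x =>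
    Submodule.mem_sup.1 (hc.sup_eq_top ▸ Submodule.mem_top : x ∈ Kp ⊔ Km)
  have hform : ∀ x y : K, KreinSpace.form x y = ⟪x, J₀ y⟫_ℂ := by
    intro x y
    obtain ⟨a, ha, b, hb, rfl⟩ := hdec x
    obtain ⟨c, hc, d, hd, rfl⟩ := hdec y
    rw [happ c hc d hd, sub_eq_add_neg, hinner a ha b hb c hc (-d) (Km.neg_mem hd)]
    simp [hort a ha d hd, hort' b hb c hc]
  have hinv : ∀ x, J₀ (J₀ x) = x := by
    intro x
    obtain ⟨a, ha, b, hb, rfl⟩ := hdec x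
    rw [happ a ha b hb, sub_eq_add_neg, happ a ha _ (Km.neg_mem hb), sub_neg_eq_add]
  have hsymm : ∀ x y, ⟪J₀ x, y⟫_ℂ = ⟪x, J₀ y⟫_ℂ := by
    intro x y
    rw [← hform, ← KreinSpace.form_conj_symm, hform, inner_conj_symm]
  have hnorm : ∀ x, ‖J₀ x‖ ≤ 1 * ‖x‖ := by
    intro x
    rw [one_mul, ← pow_le_pow_iff_left₀ (norm_nonneg _) (norm_nonneg _) two_ne_zero,
      ← re_inner_self_eq_norm_sq, hsymm, hinv, re_inner_self_eq_norm_sq]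
  exact ⟨J₀.mkContinuous 1 hnorm, ⟨hsymm, hinv⟩, hform⟩

section Definite

variable [KreinSpace K] {J : K →L[ℂ] K}

theorem companion_eq (hJ : ∀ x y : K, KreinSpace.form x y = ⟪x, J y⟫_ℂ) (L : Submodule ℂ K) :
    KreinSpace.companion L = Lᗮ.comap (J : K →ₗ[ℂ] K) := by
  ext x
  simp only [KreinSpace.companion, Submodule.mem_orthogonalBilin_iff, Submodule.mem_comap,
    Submodule.mem_orthogonal, hJ, ContinuousLinearMap.coe_coe]

theorem isUniformlyPositive_iff (hJ : ∀ x y : K, KreinSpace.form x y = ⟪x, J y⟫_ℂ) :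
    KreinSpace.IsUniformlyPositive (K := K) = IsUniformlyPositiveFor J := by
  ext L
  simp only [KreinSpace.IsUniformlyPositive, KreinSpace.IsRegular, KreinSpace.IsPositive,
    IsUniformlyPositiveFor, companion_eq hJ, hJ]

theorem isUniformlyNegative_iff (hJ : ∀ x y : K, KreinSpace.form x y = ⟪x, J y⟫_ℂ) :
    KreinSpace.IsUniformlyNegative (K := K) = IsUniformlyPositiveFor (-J) := by
  ext L
  have h : Lᗮ.comap ((-J : K →L[ℂ] K) : K →ₗ[ℂ] K) = Lᗮ.comap (J : K →ₗ[ℂ] K) := by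
    ext x
    simp
  simp only [KreinSpace.IsUniformlyNegative, KreinSpace.IsRegular, KreinSpace.IsNegative,
    IsUniformlyPositiveFor, companion_eq hJ, hJ, h, neg_apply, inner_neg_right,
    Complex.neg_re, Left.neg_pos_iff]

end Definite

end Symmetry

section Transfer

variable {H : Type u} [NormedAddCommGroup H] [InnerProductSpace ℂ H] {A : H →L[ℂ] H}

/-- The induced Kreĭn space with a given fundamental symmetry. -/
noncomputable abbrev ofIsInduced {K : Type u} [NormedAddCommGroup K] [InnerProductSpace ℂ K]
    [CompleteSpace K] {J : K →L[ℂ] K} {P : H →L[ℂ] K} (h : IsInduced A J P) :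
    InducedKreinSpace A :=
  letI := h.symm.kreinSpace
  { carrier := K
    map := P
    denseRange_map := h.denseRange
    form_map_map := fun x y => h.inner_map x y }

theorem exists_isInduced (S : InducedKreinSpace A) :
    ∃ J : S.carrier →L[ℂ] S.carrier, IsInduced A J S.map ∧
      ∀ x y : S.carrier, KreinSpace.form x y = ⟪x, J y⟫_ℂ := by
  obtain ⟨J, hJ, hform⟩ := exists_fundamentalSymmetry S.carrier
  exact ⟨J, ⟨hJ, S.denseRange_map, fun x y => by rw [← hform, S.form_map_map]⟩, hform⟩

variable [CompleteSpace H]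

theorem rangeContainsMaximalUniformlyDefinite_iff (hA : IsSelfAdjoint A)
    (S : InducedKreinSpace A) :
    S.RangeContainsMaximalUniformlyDefinite ↔ HasLateralSpectralGapAtZero A := by
  obtain ⟨J, hJ, hform⟩ := S.exists_isInduced
  rw [hasLateralSpectralGapAtZero_iff]
  simp only [RangeContainsMaximalUniformlyDefinite, KreinSpace.IsMaximalUniformlyDefinite,
    isUniformlyPositive_iff hform, isUniformlyNegative_iff hform]
  constructor
  · rintro ⟨L, hL | hL, hLS⟩
    · exact Or.inl ((hJ.hasPositiveSplitting_of_maximal hL hLS).hasRightSpectralGap hA)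
    · exact Or.inr ((hJ.neg.hasPositiveSplitting_of_maximal hL hLS).hasRightSpectralGap hA.neg)
  · rintro (h | h)
    · obtain ⟨L, hL, hLS⟩ := hJ.exists_maximal_of_hasPositiveSplitting (h.hasPositiveSplitting hA)
      exact ⟨L, Or.inl hL, hLS⟩
    · obtain ⟨L, hL, hLS⟩ :=
        hJ.neg.exists_maximal_of_hasPositiveSplitting (h.hasPositiveSplitting hA.neg)
      exact ⟨L, Or.inr hL, hLS⟩

theorem exists_norm_map_le (hA : IsSelfAdjoint A) (h : HasLateralSpectralGapAtZero A)
    (S T : InducedKreinSpace A) : ∃ C : ℝ, ∀ x, ‖T.map x‖ ≤ C * ‖S.map x‖ := by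
  obtain ⟨J, hJ, -⟩ := S.exists_isInduced
  obtain ⟨J', hJ', -⟩ := T.exists_isInduced
  rcases (hasLateralSpectralGapAtZero_iff A).1 h with h | h
  · exact hJ.exists_norm_map_le hJ' (h.hasPositiveSplitting hA)
  · exact hJ.neg.exists_norm_map_le hJ'.neg (h.hasPositiveSplitting hA.neg)

/-- Since the norms of `S.map x` and `T.map x` are equivalent, `S.map x ↦ T.map x` extends to an
isomorphism. -/
theorem unitaryEquivalent_of_gap (hA : IsSelfAdjoint A) (h : HasLateralSpectralGapAtZero A)
    (S T : InducedKreinSpace A) : S.UnitaryEquivalent T := by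
  obtain ⟨J, hJ, hform⟩ := S.exists_isInduced
  obtain ⟨J', hJ', hform'⟩ := T.exists_isInduced
  set U : S.carrier ≃L[ℂ] T.carrier := (LinearEquiv.refl ℂ H).extend
    (S.map : H →ₗ[ℂ] S.carrier) (T.map : H →ₗ[ℂ] T.carrier)
    S.denseRange_map (exists_norm_map_le hA h S T)
    T.denseRange_map (exists_norm_map_le hA h T S) with hU
  have hUmap : ∀ x : H, U (S.map x) = T.map x := fun x => LinearEquiv.extend_eq _ _ _ _ _ _ _ x
  refine ⟨U, fun x y => ?_, hUmap⟩
  rw [hform, hform']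
  refine S.denseRange_map.induction_on₂ (p := fun x y => ⟪U x, J' (U y)⟫_ℂ = ⟪x, J y⟫_ℂ)
    (isClosed_eq (by fun_prop) (by fun_prop)) (fun a b => ?_) x y
  rw [hUmap, hUmap, hJ.inner_map, hJ'.inner_map]

end Transfer

section Existence

variable {H : Type u} [NormedAddCommGroup H] [InnerProductSpace ℂ H] [CompleteSpace H]
  {A : H →L[ℂ] H}

theorem map_eq_zero_of_map_map_eq_zero {T : H →L[ℂ] H} (hT : IsSelfAdjoint T) {x : H}
    (h : T (T x) = 0) : T x = 0 := by
  rw [← inner_self_eq_zero (𝕜 := ℂ), inner_map_comm hT, h, inner_zero_right]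

/-- The canonical induced Kreĭn space: with `T` and `S` the square roots of the positive and the
negative part of `A`, it is the orthogonal sum of `(ker T)ᗮ` and `(ker S)ᗮ`, the second summand
being negative, and `Π x = (T x, S x)`. -/
theorem exists_canonical (hA : IsSelfAdjoint A) : ∃ S : InducedKreinSpace A, ∀ x y : H,
    ⟪S.map x, S.map y⟫_ℂ = ⟪sqrtPosPart A x, sqrtPosPart A y⟫_ℂ
      + ⟪sqrtPosPart (-A) x, sqrtPosPart (-A) y⟫_ℂ := by
  set T := sqrtPosPart A with hTdef
  set S := sqrtPosPart (-A) with hSdef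
  have hT : IsSelfAdjoint T := isSelfAdjoint_sqrtPosPart A
  have hS : IsSelfAdjoint S := isSelfAdjoint_sqrtPosPart (-A)
  let e := WithLp.prodContinuousLinearEquiv 2 ℂ T.kerᗮ S.kerᗮ
  let P : H →L[ℂ] WithLp 2 (T.kerᗮ × S.kerᗮ) :=
    (e.symm : _ →L[ℂ] _) ∘L ((T.codRestrict T.kerᗮ (map_mem_orthogonal_ker hT)).prod
      (S.codRestrict S.kerᗮ (map_mem_orthogonal_ker hS)))
  let J : WithLp 2 (T.kerᗮ × S.kerᗮ) →L[ℂ] WithLp 2 (T.kerᗮ × S.kerᗮ) :=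
    (e.symm : _ →L[ℂ] _) ∘L ((ContinuousLinearMap.fst ℂ T.kerᗮ S.kerᗮ).prod
      (-ContinuousLinearMap.snd ℂ T.kerᗮ S.kerᗮ)) ∘L (e : _ →L[ℂ] _)
  have hP : ∀ (v : WithLp 2 (T.kerᗮ × S.kerᗮ)) (x : H),
      ⟪v, P x⟫_ℂ = ⟪(v.fst : H), T x⟫_ℂ + ⟪(v.snd : H), S x⟫_ℂ :=
    fun v x => WithLp.prod_inner_apply _ _
  have hJ1 : ∀ v, (J v).fst = v.fst := fun v => rfl
  have hJ2 : ∀ v, (J v).snd = -v.snd := fun v => rfl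
  have hsymm : IsFundamentalSymmetry J := by
    refine ⟨fun x y => ?_, fun x => ?_⟩
    · rw [WithLp.prod_inner_apply, WithLp.prod_inner_apply, ← inner_neg_neg (J x).ofLp.2]
      change ⟪(J x).fst, y.fst⟫_ℂ + ⟪-(J x).snd, -y.snd⟫_ℂ
        = ⟪x.fst, (J y).fst⟫_ℂ + ⟪x.snd, (J y).snd⟫_ℂ
      rw [hJ1, hJ1, hJ2, hJ2, neg_neg]
    · refine WithLp.ofLp_injective 2 (Prod.ext rfl ?_)
      exact neg_neg x.snd
  have hdense : DenseRange P := by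
    have : P.range.topologicalClosure = ⊤ := by
      rw [Submodule.topologicalClosure_eq_top_iff, Submodule.eq_bot_iff]
      intro v hv
      have h0 : T v.fst + S v.snd = 0 := by
        refine ext_inner_right ℂ fun x => ?_
        have h1 := (Submodule.mem_orthogonal' _ _).1 hv (P x) ⟨x, rfl⟩
        rw [hP] at h1
        rw [inner_add_left, inner_map_comm hT, inner_map_comm hS, h1, inner_zero_left]
      have hT0 : T v.fst = 0 := by
        refine map_eq_zero_of_map_map_eq_zero hT ?_
        have h1 := congrArg T h0
        rwa [map_add, sqrtPosPart_sqrtPosPart_neg hA, add_zero, map_zero] at h1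
      have hS0 : S v.snd = 0 := by rwa [hT0, zero_add] at h0
      refine WithLp.ofLp_injective 2 (Prod.ext (Subtype.ext ?_) (Subtype.ext ?_))
      · exact inner_self_eq_zero.1 ((Submodule.mem_orthogonal _ _).1 v.fst.2 v.fst hT0)
      · exact inner_self_eq_zero.1 ((Submodule.mem_orthogonal _ _).1 v.snd.2 v.snd hS0)
    exact (Submodule.dense_iff_topologicalClosure_eq_top (s := P.range)).2 this
  have hind : IsInduced A J P := by
    refine ⟨hsymm, hdense, fun x y => ?_⟩
    rw [← hsymm.inner_comm, hP, hJ1, hJ2, inner_apply_eq_sub hA x y]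
    change ⟪T x, T y⟫_ℂ + ⟪-S x, S y⟫_ℂ = _
    rw [inner_neg_left, sub_eq_add_neg]
  exact ⟨ofIsInduced hind, fun x y => hP (P x) y⟩

end Existence

/-! ### Non-uniqueness in the absence of a gap -/

section Sequences

variable {H : Type*} [NormedAddCommGroup H] [InnerProductSpace ℂ H] [CompleteSpace H]

/-- If a selfadjoint operator is bounded below on the part of its range orthogonal to finitely many
vectors `T x`, then it is bounded below on `(ker T)ᗮ`: finitely many dimensions do not affect
closedness of the range. -/
theorem exists_mul_norm_sq_le_of_finite {T : H →L[ℂ] H} (hT : IsSelfAdjoint T) (s : Finset H)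
    {δ : ℝ} (hδ : 0 < δ)
    (h : ∀ g, (∀ x ∈ s, ⟪T x, T g⟫_ℂ = 0) → δ * ‖T g‖ ≤ ‖T (T g)‖) :
    ∃ c : ℝ, 0 < c ∧ ∀ u ∈ T.kerᗮ, c * ‖u‖ ^ 2 ≤ ‖T u‖ ^ 2 := by
  set F : Submodule ℂ H := Submodule.span ℂ (s : Set H) with hF
  have hFfin : FiniteDimensional ℂ F := FiniteDimensional.span_finset ℂ s
  set E : Submodule ℂ H := F.map (T : H →ₗ[ℂ] H) with hE
  have hEker : E ≤ T.kerᗮ := by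
    rintro _ ⟨x, -, rfl⟩
    exact map_mem_orthogonal_ker hT x
  have hbound : ∀ u ∈ T.kerᗮ, δ * ‖u - E.starProjection u‖ ≤ ‖T (u - E.starProjection u)‖ := by
    intro u hu
    rw [← SetLike.mem_coe, ← closure_range_eq_orthogonal_ker hT] at hu
    refine closure_minimal
      (t := {u | δ * ‖u - E.starProjection u‖ ≤ ‖T (u - E.starProjection u)‖}) ?_
      (isClosed_le (by fun_prop) (by fun_prop)) hu
    rintro _ ⟨y, rfl⟩
    obtain ⟨x, -, hx⟩ := E.starProjection_apply_mem (T y)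
    have hx' : T y - E.starProjection (T y) = T (y - x) := by rw [map_sub, ← hx]; rfl
    change δ * ‖T y - E.starProjection (T y)‖ ≤ ‖T (T y - E.starProjection (T y))‖
    rw [hx']
    refine h _ fun z hz => ?_
    rw [← hx']
    exact (Submodule.mem_orthogonal _ _).1 (E.sub_starProjection_mem_orthogonal (T y)) (T z)
      ⟨z, Submodule.subset_span hz, rfl⟩
  have hbound' : ∀ u ∈ T.kerᗮ ⊓ Eᗮ, δ * ‖u‖ ≤ ‖T u‖ := by
    intro u hu
    have := hbound u hu.1
    rwa [E.starProjection_apply_eq_zero_iff.2 hu.2, sub_zero] at this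
  have hGcl : IsClosed ((T.kerᗮ ⊓ Eᗮ : Submodule ℂ H) : Set H) :=
    (Submodule.isClosed_orthogonal _).inter (Submodule.isClosed_orthogonal _)
  have hGcomp : CompleteSpace (T.kerᗮ ⊓ Eᗮ : Submodule ℂ H) := hGcl.completeSpace_coe
  have hRcomp : CompleteSpace T.kerᗮ := (Submodule.isClosed_orthogonal _).completeSpace_coe
  have hGimage : IsClosed (((T.kerᗮ ⊓ Eᗮ).map (T : H →ₗ[ℂ] H) : Submodule ℂ H) : Set H) := by
    have hanti : AntilipschitzWith (Real.toNNReal δ⁻¹) (T ∘L (T.kerᗮ ⊓ Eᗮ).subtypeL) := by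
      refine ContinuousLinearMap.antilipschitz_of_bound _ fun u => ?_
      rw [Real.coe_toNNReal _ (inv_pos.2 hδ).le, inv_mul_eq_div, le_div_iff₀ hδ, mul_comm]
      exact hbound' u u.2
    convert hanti.isClosed_range (T ∘L (T.kerᗮ ⊓ Eᗮ).subtypeL).uniformContinuous using 1
    ext x
    simp
  have himage : IsClosed (Set.range (T ∘L T.kerᗮ.subtypeL)) := by
    convert Submodule.isClosed_sup_finiteDimensional _ (E.map (T : H →ₗ[ℂ] H)) hGimage using 1
    ext x
    rw [← Submodule.map_sup, SetLike.mem_coe, Submodule.mem_map]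
    constructor
    · rintro ⟨u, rfl⟩
      refine ⟨u, Submodule.mem_sup.2 ⟨u - E.starProjection u, ⟨?_, ?_⟩, E.starProjection (u : H),
        E.starProjection_apply_mem _, by abel⟩, rfl⟩
      · exact Submodule.sub_mem _ u.2 (hEker (E.starProjection_apply_mem _))
      · exact E.sub_starProjection_mem_orthogonal _
    · rintro ⟨u, hu, rfl⟩
      exact ⟨⟨u, (sup_le inf_le_left hEker) hu⟩, rfl⟩
  have hinj : Function.Injective (T ∘L T.kerᗮ.subtypeL) := by
    refine (injective_iff_map_eq_zero _).2 fun u hu => Subtype.ext ?_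
    have h1 : (u : H) ∈ T.ker := hu
    exact inner_self_eq_zero.1 ((Submodule.mem_orthogonal _ _).1 u.2 u h1)
  obtain ⟨κ, hκ⟩ := ContinuousLinearMap.antilipschitz_of_injective_of_isClosed_range
    (T ∘L T.kerᗮ.subtypeL) hinj himage
  refine ⟨((κ + 1 : ℝ) ^ 2)⁻¹, by positivity, fun u hu => ?_⟩
  rw [inv_mul_le_iff₀ (by positivity), ← mul_pow]
  have h1 : ‖u‖ ≤ κ * ‖T u‖ := hκ.le_mul_norm (map_zero _) (⟨u, hu⟩ : T.kerᗮ)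
  gcongr
  refine h1.trans ?_
  gcongr
  linarith

/-- A selfadjoint operator that is not bounded below on `(ker T)ᗮ` has an orthonormal sequence of
rapidly decreasing approximate eigenvectors to the eigenvalue `0`, of the form `T (g n)`. -/
theorem exists_orthonormal_seq {T : H →L[ℂ] H} (hT : IsSelfAdjoint T)
    (h : ¬ ∃ c : ℝ, 0 < c ∧ ∀ u ∈ T.kerᗮ, c * ‖u‖ ^ 2 ≤ ‖T u‖ ^ 2) :
    ∃ g : ℕ → H, (∀ n, g n ∈ T.kerᗮ) ∧ Orthonormal ℂ (fun n => T (g n)) ∧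
      ∀ n, ‖T (T (g n))‖ ≤ (1 / 4) ^ n := by
  have step : ∀ (s : Finset H) (δ : ℝ), 0 < δ → ∃ g ∈ T.kerᗮ, ‖T g‖ = 1 ∧ ‖T (T g)‖ ≤ δ ∧
      ∀ x ∈ s, ⟪T x, T g⟫_ℂ = 0 := by
    intro s δ hδ
    by_contra! hcon
    refine h (exists_mul_norm_sq_le_of_finite hT s hδ fun g hg => ?_)
    by_contra! hlt
    have hpos : 0 < ‖T g‖ := by
      by_contra! h0
      have h1 : T g = 0 := norm_le_zero_iff.1 h0
      simp [h1] at hlt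
    have hkercomp : CompleteSpace T.ker := T.isClosed_ker.completeSpace_coe
    obtain ⟨k, hk, g', hg', rfl⟩ := Submodule.mem_sup.1
      (T.ker.sup_orthogonal_of_hasOrthogonalProjection ▸ Submodule.mem_top : g ∈ T.ker ⊔ T.kerᗮ)
    have hTg : T (k + g') = T g' := by rw [map_add, show T k = 0 from hk, zero_add]
    rw [hTg] at hlt hpos hg
    set a : ℂ := ((‖T g'‖⁻¹ : ℝ) : ℂ) with ha
    have hna : ‖a‖ = ‖T g'‖⁻¹ := by
      rw [ha, Complex.norm_real, Real.norm_of_nonneg (by positivity)]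
    obtain ⟨x, hx, hx'⟩ := hcon (a • g') (Submodule.smul_mem _ _ hg')
      (by rw [map_smul, norm_smul, hna, inv_mul_cancel₀ hpos.ne'])
      (by rw [map_smul, map_smul, norm_smul, hna, inv_mul_le_iff₀ hpos, mul_comm]; exact hlt.le)
    rw [map_smul, inner_smul_right, hg x hx, mul_zero] at hx'
    exact hx' rfl
  classical
  -- The index in the first component records the required decay.
  obtain ⟨f, hf, hf'⟩ := exists_seq_of_forall_finset_exists
    (fun y : ℕ × H => y.2 ∈ T.kerᗮ ∧ ‖T y.2‖ = 1 ∧ ‖T (T y.2)‖ ≤ (1 / 4) ^ y.1)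
    (fun x y : ℕ × H => x.1 < y.1 ∧ ⟪T x.2, T y.2⟫_ℂ = 0) (fun s _ => by
      obtain ⟨g, hg, h1, h2, h3⟩ := step (s.image Prod.snd) ((1 / 4) ^ (s.sup Prod.fst + 1))
        (by positivity)
      exact ⟨(s.sup Prod.fst + 1, g), ⟨hg, h1, h2⟩, fun x hx =>
        ⟨Nat.lt_succ_of_le (Finset.le_sup (f := Prod.fst) hx),
          h3 _ (Finset.mem_image_of_mem _ hx)⟩⟩)
  have hmono : StrictMono fun n => (f n).1 := fun m n hmn => (hf' m n hmn).1
  refine ⟨fun n => (f n).2, fun n => (hf n).1, ⟨fun n => (hf n).2.1, fun m n hmn => ?_⟩,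
    fun n => (hf n).2.2.trans
      (pow_le_pow_of_le_one (by norm_num) (by norm_num) (hmono.le_apply))⟩
  rcases lt_or_gt_of_ne hmn with h | h
  · exact (hf' m n h).2
  · exact inner_eq_zero_symm.1 (hf' n m h).2

end Sequences

section Perturbation

variable {H K : Type*} [NormedAddCommGroup H] [InnerProductSpace ℂ H] [CompleteSpace H]
  [NormedAddCommGroup K] [InnerProductSpace ℂ K] [CompleteSpace K]
  {A : H →L[ℂ] H} {J : K →L[ℂ] K} {P : H →L[ℂ] K}

/-- The neutral vectors `z n = P (p n + q n)` are orthogonal for both inner products of `K`, so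
`V x = x + i ∑ 2ⁿ [z n, x] z n` preserves the indefinite inner product.  It is unbounded, but
`V P` is bounded because `[z n, P x] = ⟪A (p n + q n), x⟫` is small. -/
theorem IsInduced.exists_not_factor (h : IsInduced A J P) (hA : IsSelfAdjoint A) {p q : ℕ → H}
    (hp : ∀ n, J (P (p n)) = P (p n)) (hq : ∀ n, J (P (q n)) = -P (q n))
    (hpo : Orthonormal ℂ fun n => P (p n)) (hqo : Orthonormal ℂ fun n => P (q n))
    (hAp : ∀ n, ‖A (p n)‖ ≤ (1 / 4) ^ n) (hAq : ∀ n, ‖A (q n)‖ ≤ (1 / 4) ^ n) :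
    ∃ P' : H →L[ℂ] K, IsInduced A J P' ∧ ∀ U : K →L[ℂ] K, ¬ ∀ x, U (P x) = P' x := by
  have hpq : ∀ m n, ⟪P (p m), P (q n)⟫_ℂ = 0 := by
    intro m n
    have h1 := h.symm.inner_comm (P (p m)) (P (q n))
    rw [hp, hq, inner_neg_right, eq_neg_iff_add_eq_zero, ← two_mul] at h1
    exact (mul_eq_zero.1 h1).resolve_left two_ne_zero
  have hqp : ∀ m n, ⟪P (q m), P (p n)⟫_ℂ = 0 := fun m n => inner_eq_zero_symm.1 (hpq n m)
  set z : ℕ → K := fun n => P (p n + q n) with hz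
  set w : ℕ → K := fun n => P (p n - q n) with hw
  have hJz : ∀ n, J (z n) = w n := fun n => by
    simp only [hz, hw, map_add, map_sub P, hp, hq, ← sub_eq_add_neg]
  have hJw : ∀ n, J (w n) = z n := fun n => by rw [← hJz, h.symm.involutive]
  have hzz : ∀ m n, ⟪z m, z n⟫_ℂ = if m = n then 2 else 0 := by
    intro m n
    simp only [hz, map_add, inner_add_left, inner_add_right, hpq, hqp,
      orthonormal_iff_ite.1 hpo m n, orthonormal_iff_ite.1 hqo m n]
    split_ifs <;> norm_num
  have hzw : ∀ m n, ⟪z m, w n⟫_ℂ = 0 := by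
    intro m n
    simp only [hz, hw, map_add, map_sub, inner_add_left, inner_sub_right, hpq, hqp,
      orthonormal_iff_ite.1 hpo m n, orthonormal_iff_ite.1 hqo m n]
    split_ifs <;> norm_num
  have hznorm : ∀ n, ‖z n‖ ^ 2 = 2 := fun n => by
    rw [← re_inner_self_eq_norm_sq, hzz, if_pos rfl]
    rfl
  have hwnorm : ∀ n, ‖w n‖ = ‖z n‖ := fun n => by rw [← hJz, h.symm.norm_map]
  have hzpos : ∀ n, 0 < ‖z n‖ := fun n => by
    have := hznorm n
    by_contra! h0
    rw [le_antisymm h0 (norm_nonneg _)] at this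
    norm_num at this
  have hzle : ∀ n, ‖z n‖ ≤ 2 := fun n => by nlinarith [hznorm n, norm_nonneg (z n)]
  -- The coefficients `[z n, P x]`.
  set b : ℕ → H := fun n => A (p n + q n) with hb
  have hbP : ∀ n x, ⟪b n, x⟫_ℂ = ⟪z n, J (P x)⟫_ℂ := fun n x => by
    rw [hb, hz, h.inner_map]
    exact inner_map_comm hA _ _
  have hPb : ∀ n x, ⟪P x, J (z n)⟫_ℂ = conj ⟪b n, x⟫_ℂ := fun n x => by
    rw [hbP, h.symm.inner_conj]
  have hbn : ∀ n, ‖b n‖ ≤ 2 * (1 / 4) ^ n := fun n => by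
    rw [hb]
    simp only [map_add]
    exact (norm_add_le _ _).trans (by linarith [hAp n, hAq n])
  set τ : ℕ → ℂ := fun n => Complex.I * 2 ^ n with hτ
  have hτn : ∀ n, ‖τ n‖ = 2 ^ n := fun n => by simp [hτ]
  have hτc : ∀ n, conj (τ n) = -τ n := fun n => by
    simp only [hτ, map_mul, map_pow, Complex.conj_I, Complex.conj_ofNat, neg_mul]
  set D : ℕ → H →L[ℂ] K := fun n => τ n • (innerSL ℂ (b n)).smulRight (z n) with hD
  have hDapp : ∀ n x, D n x = (τ n * ⟪b n, x⟫_ℂ) • z n := fun n x => by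
    simp [hD, smul_smul]
  have hsum : Summable D := by
    refine Summable.of_norm_bounded (g := fun n => 4 * (1 / 2 : ℝ) ^ n)
      (summable_geometric_two.mul_left 4) fun n => ?_
    rw [hD]
    calc ‖τ n • (innerSL ℂ (b n)).smulRight (z n)‖ = 2 ^ n * (‖b n‖ * ‖z n‖) := by
          rw [norm_smul, hτn, ContinuousLinearMap.norm_smulRight_apply, innerSL_apply_norm]
      _ ≤ 2 ^ n * (2 * (1 / 4) ^ n * 2) := by
          gcongr
          · exact hbn n
          · exact hzle n
      _ = 4 * (2 ^ n * (1 / 4) ^ n) := by ring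
      _ = 4 * (1 / 2) ^ n := by rw [← mul_pow]; norm_num
  set Δ : H →L[ℂ] K := ∑' n, D n with hΔ
  have hΔapp : ∀ x, HasSum (fun n => (τ n * ⟪b n, x⟫_ℂ) • z n) (Δ x) := fun x => by
    have := hsum.hasSum.mapL (ContinuousLinearMap.apply ℂ K x)
    simpa only [ContinuousLinearMap.apply_apply, hDapp] using this
  have hΔinner : ∀ v x,
      HasSum (fun n => τ n * ⟪b n, x⟫_ℂ * ⟪v, J (z n)⟫_ℂ) ⟪v, J (Δ x)⟫_ℂ := fun v x => by
    have := (hΔapp x).mapL (innerSL ℂ v ∘L J)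
    simpa only [ContinuousLinearMap.comp_apply, innerSL_apply_apply, map_smul, smul_eq_mul]
      using this
  have hcross : ∀ x y, ⟪P x, J (Δ y)⟫_ℂ + ⟪Δ x, J (P y)⟫_ℂ = 0 := by
    intro x y
    rw [← h.symm.inner_conj (P y) (Δ x)]
    have h1 := hΔinner (P x) y
    have h2 := Complex.hasSum_conj'.2 (hΔinner (P y) x)
    refine (h1.add h2).unique ?_
    convert hasSum_zero (α := ℂ) (β := ℕ) using 2 with n
    simp only [hPb, map_mul, hτc, Complex.conj_conj]
    ring
  have hΔz : ∀ n x, ⟪z n, J (Δ x)⟫_ℂ = 0 := by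
    intro n x
    refine (hΔinner (z n) x).unique ?_
    convert hasSum_zero (α := ℂ) (β := ℕ) using 2 with m
    rw [hJz, hzw, mul_zero]
  have hneutral : ∀ x y, ⟪Δ x, J (Δ y)⟫_ℂ = 0 := by
    intro x y
    refine (hΔinner (Δ x) y).unique ?_
    convert hasSum_zero (α := ℂ) (β := ℕ) using 2 with m
    rw [h.symm.inner_eq_zero_symm (hΔz m x), mul_zero]
  have hadd : ∀ n, Δ (p n + q n) = 0 := by
    intro n
    refine (hΔapp _).unique ?_
    convert hasSum_zero (α := K) (β := ℕ) using 2 with m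
    rw [hbP, show P (p n + q n) = z n from rfl, hJz, hzw, mul_zero, zero_smul]
  have hsub : ∀ n, Δ (p n - q n) = (τ n * 2) • z n := by
    intro n
    refine (hΔapp _).unique ?_
    convert hasSum_single n fun m hm => ?_ using 1
    · rw [hbP, show P (p n - q n) = w n from rfl, hJw, hzz, if_pos rfl]
    · rw [hbP, show P (p n - q n) = w n from rfl, hJw, hzz, if_neg hm, mul_zero, zero_smul]
  refine ⟨P + Δ, ⟨h.symm, ?_, fun x y => ?_⟩, fun U hU => ?_⟩
  · have : (P + Δ).range.topologicalClosure = ⊤ := by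
      rw [Submodule.topologicalClosure_eq_top_iff, Submodule.eq_bot_iff]
      intro y hy
      have hy' : ∀ x, ⟪y, (P + Δ) x⟫_ℂ = 0 := fun x =>
        (Submodule.mem_orthogonal' _ _).1 hy _ ⟨x, rfl⟩
      have hyz : ∀ n, ⟪y, z n⟫_ℂ = 0 := fun n => by
        have := hy' (p n + q n)
        rwa [add_apply, hadd, add_zero] at this
      have hyΔ : ∀ x, ⟪y, Δ x⟫_ℂ = 0 := by
        intro x
        have hJy : ∀ v, ⟪J y, J v⟫_ℂ = ⟪y, v⟫_ℂ := fun v => by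
          rw [h.symm.inner_comm, h.symm.involutive]
        rw [← hJy]
        refine (hΔinner (J y) x).unique ?_
        convert hasSum_zero (α := ℂ) (β := ℕ) using 2 with n
        rw [hJy, hyz, mul_zero]
      have hyP : ∀ x, ⟪y, P x⟫_ℂ = 0 := fun x => by
        have := hy' x
        rwa [add_apply, inner_add_right, hyΔ, add_zero] at this
      exact h.denseRange.eq_zero_of_inner_left (𝕜 := ℂ)
        hyP
    exact (Submodule.dense_iff_topologicalClosure_eq_top (s := (P + Δ).range)).2 this
  · have h1 := hcross x y
    rw [add_apply, add_apply, map_add, inner_add_left, inner_add_right, inner_add_right,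
      hneutral, h.inner_map, add_zero]
    linear_combination h1
  · obtain ⟨n, hn⟩ := exists_nat_gt (‖U‖ + 1)
    have h1 : (τ n * 2) • z n = U (w n) - w n := by
      rw [hw, hU, add_apply, hsub, add_sub_cancel_left]
    have h2 : ‖(τ n * 2) • z n‖ = 2 ^ n * 2 * ‖z n‖ := by
      rw [norm_smul, norm_mul, hτn]
      norm_num
    have h3 : ‖U (w n) - w n‖ ≤ (‖U‖ + 1) * ‖z n‖ := by
      calc ‖U (w n) - w n‖ ≤ ‖U (w n)‖ + ‖w n‖ := norm_sub_le _ _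
        _ ≤ ‖U‖ * ‖w n‖ + ‖w n‖ := by gcongr; exact U.le_opNorm _
        _ = _ := by rw [hwnorm]; ring
    rw [← h1, h2] at h3
    have h4 := le_of_mul_le_mul_right h3 (hzpos n)
    have h5 : (n : ℝ) < 2 ^ n := by exact_mod_cast Nat.lt_two_pow_self
    linarith

end Perturbation

section Uniqueness

variable {H : Type u} [NormedAddCommGroup H] [InnerProductSpace ℂ H] [CompleteSpace H]
  {A : H →L[ℂ] H}

/-- Without a gap on the right, the square root of the positive part of `A` provides an orthonormal
sequence in the positive part of the canonical induced Kreĭn space. -/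
theorem exists_orthonormal_seq_of_not_gap (hA : IsSelfAdjoint A) (h : ¬ HasRightSpectralGap A) :
    ∃ g : ℕ → H, (∀ n, sqrtPosPart (-A) (g n) = 0) ∧
      Orthonormal ℂ (fun n => sqrtPosPart A (g n)) ∧ ∀ n, ‖A (g n)‖ ≤ (1 / 4) ^ n := by
  obtain ⟨g, hg, ho, hn⟩ := exists_orthonormal_seq (isSelfAdjoint_sqrtPosPart A)
    fun ⟨c, hc, hcT⟩ =>
      h ((HasPositiveSplitting.of_le_norm_sqrtPosPart hA hc hcT).hasRightSpectralGap hA)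
  refine ⟨g, fun n => sqrtPosPart_neg_eq_zero hA (hg n), ho, fun n => ?_⟩
  rw [apply_eq_sub hA, sqrtPosPart_neg_eq_zero hA (hg n), map_zero, sub_zero]
  exact hn n

/-- If `A` has no gap on either side of `0`, the canonical induced Kreĭn space is inequivalent to
a perturbation of it along approximate eigenvectors from both sides. -/
theorem gap_of_unique (hA : IsSelfAdjoint A) (h : InducedKreinSpaceUnique A) :
    HasLateralSpectralGapAtZero A := by
  rw [hasLateralSpectralGapAtZero_iff]
  by_contra! hcon
  obtain ⟨p, hp0, hpo, hpA⟩ := exists_orthonormal_seq_of_not_gap hA hcon.1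
  obtain ⟨q, hq0, hqo, hqA⟩ := exists_orthonormal_seq_of_not_gap hA.neg hcon.2
  rw [neg_neg] at hq0
  obtain ⟨S, hS⟩ := exists_canonical hA
  obtain ⟨J, hJ, hform⟩ := S.exists_isInduced
  have hdense : ∀ a b : S.carrier, (∀ x, ⟪S.map x, a⟫_ℂ = ⟪S.map x, b⟫_ℂ) → a = b :=
    fun a b hab => S.denseRange_map.eq_of_inner_right (𝕜 := ℂ)
      hab
  obtain ⟨P', hP', hno⟩ := hJ.exists_not_factor hA (p := p) (q := q)
    (fun n => hdense _ _ fun x => by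
      rw [hJ.inner_map, hS, inner_apply_eq_sub hA, hp0, inner_zero_right]; ring)
    (fun n => hdense _ _ fun x => by
      rw [hJ.inner_map, inner_neg_right, hS, inner_apply_eq_sub hA, hq0, inner_zero_right]; ring)
    (by simpa only [orthonormal_iff_ite, hS, hp0, inner_zero_right, add_zero] using hpo)
    (by simpa only [orthonormal_iff_ite, hS, hq0, inner_zero_right, zero_add] using hqo)
    hpA (by simpa using hqA)
  obtain ⟨U, -, hU⟩ := h.2 S (ofIsInduced hP')
  exact hno U hU

end Uniqueness

end InducedKreinSpace

open InducedKreinSpace in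
theorem theorem6p1 {H : Type u} [NormedAddCommGroup H] [InnerProductSpace ℂ H] [CompleteSpace H]
    (A : H →L[ℂ] H) (hA : IsSelfAdjoint A) :
    List.TFAE [
      InducedKreinSpaceUnique A,
      HasLateralSpectralGapAtZero A,
      ∃ S : InducedKreinSpace A, S.RangeContainsMaximalUniformlyDefinite,
      ∀ S : InducedKreinSpace A, S.RangeContainsMaximalUniformlyDefinite] := by
  obtain ⟨S₀, -⟩ := exists_canonical hA
  tfae_have 1 → 2 := gap_of_unique hA
  tfae_have 2 → 1 := fun h => ⟨⟨S₀⟩, unitaryEquivalent_of_gap hA h⟩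
  tfae_have 2 → 4 := fun h S => (rangeContainsMaximalUniformlyDefinite_iff hA S).2 h
  tfae_have 4 → 3 := fun h => ⟨S₀, h S₀⟩
  tfae_have 3 → 2 := fun ⟨S, hS⟩ => (rangeContainsMaximalUniformlyDefinite_iff hA S).1 hS
  tfae_finish
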